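/- **Notation.** Write $e(x)=\mathrm e^{2\pi\mathrm i x}$, $\mathbb T=\mathbb R/\mathbb Z$, $\{x\}$ for the fractional part and $\|x\|$ for the distance of $x\in\mathbb R$ to the nearest integer. For $\alpha\in\mathbb R$ let $\Lambda_\alpha(p,q)=(p+\alpha,\,q+p)$ be the skew translation of $\mathbb T^2$, and for $k,\ell\in\mathbb Z$ let $\psi_{k,\ell}(p,q)=e(kp+\ell q)$ and $$S_{N,\alpha}[\psi_{k,\ell}]=\sum_{n=1}^N\psi_{k,\ell}\circ\Lambda_\alpha^n .$$ For $u\in\mathbb R$ and $N\in\mathbb N=\{1,2,\dots\}$ let $c_N(u)=\min\{c\in\mathbb N:\|cu\|\le 1/N\}$, let $d_N(u)$ be the unique integer with $-\tfrac12\le c_N(u)u+d_N(u)<\tfrac12$ (it is coprime to $c_N(u)$), and let $a_N(u)$ be an inverse of $d_N(u)$ modulo $c_N(u)$. Let $\widetilde\rho_{N,\alpha}$ be the law on $\mathbb C$ of $$\widetilde X_{N,\alpha}=\frac{S_{N,\alpha}[\psi_{k,\ell}](p,q)}{\sqrt{c_N(\ell\alpha)}},$$ where $(p,q)$ is uniformly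 distributed in $\mathbb T^2$. For $\omega,\varphi\in\mathbb R$ let $\nu_{\omega,\varphi}$ be the law on $\mathbb C$ of $$Y_{\omega,\varphi}=\frac{e(t)}{2\pi}\,\Bigg|\sum_{n\in\mathbb Z}\frac{1+e(t'-n\varphi)}{n-y}\;e\big(\tfrac12(n-y)^2\omega+nx\big)\Bigg| ,$$ where $(t,t',x,y)$ is uniformly distributed in $[0,1)^4$ and the series, which is not absolutely convergent, is understood as the limit in probability of its partial sums over finite sets $s\subset\mathbb Z$ (along the finite subsets of $\mathbb Z$ directed by inclusion); this limit exists. **Theorem.** Let $\alpha\in\mathbb R$, $k\in\mathbb Z$, $\ell\in\mathbb Z\setminus\{0\}$, put $u=\ell\alpha$, and let $(N_i)_{i\in\mathbb N}$ be a sequence of natural numbers tending to infinity such that, for some $\varphi,\omega\in\mathbb R$, $$\Big\{\frac{N_i}{c_{N_i}(u)}\Big\}\to\varphi,\qquad \Big\{\frac{a_{N_i}(u)}{c_{N_i}(u)}\Big\}\to\omega,$$ and $$\frac{c_{N_i}(u)}{N_i}\to0,\qquad \limsup_{i\to\infty}\frac{N_i^2\,\|c_{N_i}(u)\,u\|}{c_{N_i}(u)}<\infty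 .$$ Then $\widetilde\rho_{N_i,\alpha}$ converges weakly to $\nu_{\omega,\varphi}$. -/

import Mathlib

open MeasureTheory Filter Topology

noncomputable section

namespace SkewSums

/-- `e(x) = exp(2πix)`. -/
def e (x : ℝ) : ℂ := Complex.exp (2 * Real.pi * Complex.I * (x : ℂ))

/-! ### Skew translations of the torus and their Birkhoff sums -/

/-- The two-dimensional torus `ℝ² / ℤ²`. -/
abbrev Torus2 : Type := UnitAddCircle × UnitAddCircle

/-- The skew translation `(p, q) ↦ (p + α, q + p)`. -/
def skew (α : ℝ) (z : Torus2) : Torus2 := (z.1 + (α : UnitAddCircle), z.2 + z.1)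

/-- The harmonic `ψ_{k,ℓ}(p, q) = e(kp + ℓq)`. -/
def harmonic (k l : ℤ) (z : Torus2) : ℂ :=
  (AddCircle.toCircle (k • z.1 + l • z.2) : ℂ)

/-- The Birkhoff sum `∑_{n=1}^N ψ_{k,ℓ}(Λ_α^n (p, q))`. -/
def birkhoff (N : ℕ) (α : ℝ) (k l : ℤ) (z : Torus2) : ℂ :=
  ∑ n ∈ Finset.Icc 1 N, harmonic k l ((skew α)^[n] z)

/-! ### The arithmetic data attached to `u` and `N` -/

/-- The distance of a real number to the nearest integer. -/
def distInt (x : ℝ) : ℝ := |x - round x|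

/-- `c_N(u)`, the least `c ∈ {1, 2, …}` with `‖cu‖ ≤ 1/N`. -/
def cN (N : ℕ) (u : ℝ) : ℕ := sInf {c : ℕ | 0 < c ∧ distInt (c * u) ≤ (N : ℝ)⁻¹}

/-- `d_N(u)`, the integer `d` with `-1/2 ≤ c_N(u) u + d < 1/2`. -/
def dN (N : ℕ) (u : ℝ) : ℤ := -⌊(cN N u : ℝ) * u + 1 / 2⌋

/-- `a_N(u)`, the representative in `{0, …, c_N(u) - 1}` of the inverse of `d_N(u)`
modulo `c_N(u)`. -/
def aN (N : ℕ) (u : ℝ) : ℕ := ZMod.val ((dN N u : ZMod (cN N u))⁻¹)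

/-! ### The law of the renormalised Birkhoff sum -/

/-- The Birkhoff sum divided by `√(c_N(ℓα))`. -/
def renormSum (N : ℕ) (α : ℝ) (k l : ℤ) (z : Torus2) : ℂ :=
  birkhoff N α k l z / (Real.sqrt (cN N ((l : ℝ) * α)) : ℂ)

theorem continuous_renormSum (N : ℕ) (α : ℝ) (k l : ℤ) : Continuous (renormSum N α k l) := by
  have hs : Continuous (skew α) := by
    unfold skew
    fun_prop
  have hh : Continuous (harmonic k l) := by
    unfold harmonic
    exact continuous_subtype_val.comp (AddCircle.continuous_toCircle.comp (by fun_prop))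
  unfold renormSum birkhoff
  exact (continuous_finsetSum _ fun n _ => hh.comp (hs.iterate n)).div_const _

/-- The uniform law (Lebesgue measure) on the torus. -/
def uniformTorus2 : ProbabilityMeasure Torus2 :=
  ⟨volume, by
    have : IsProbabilityMeasure (volume : Measure UnitAddCircle) := ⟨by simp⟩
    infer_instance⟩

/-- The law of the renormalised Birkhoff sum, for `(p, q)` uniformly distributed. -/
def rhoTilde (N : ℕ) (α : ℝ) (k l : ℤ) : ProbabilityMeasure ℂ :=
  uniformTorus2.map (continuous_renormSum N α k l).measurable.aemeasurable

/-! ### The limit random variable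

The torus `𝕋^d` is represented by the unit cube `[0,1)^d`. -/

/-- The uniform law on `[0,1)`. -/
def unif : Measure ℝ := volume.restrict (Set.Ico 0 1)

instance : IsProbabilityMeasure unif := ⟨by simp [unif]⟩

/-- The uniform law of `(t', x, y)`. -/
def unif3 : Measure (ℝ × ℝ × ℝ) := unif.prod (unif.prod unif)

instance : IsProbabilityMeasure unif3 := by unfold unif3; infer_instance

/-- The `n`-th term of the random series, at the point `(t', x, y)`. -/
def seriesTerm (ω φ : ℝ) (n : ℤ) (z : ℝ × ℝ × ℝ) : ℂ :=
  (1 + e (z.1 - n * φ)) / ((n : ℂ) - (z.2.2 : ℂ)) *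
    e (1 / 2 * ((n : ℝ) - z.2.2) ^ 2 * ω + n * z.2.1)

/-- `Z` is the sum over `n ∈ ℤ` of the random series: the finite partial sums over finite sets
`s ⊂ ℤ` converge to `Z` in probability, along the directed set of finite subsets of `ℤ`.
The terms are of size `1/|n|` only, so the series is not absolutely convergent. -/
def IsSeriesSum (ω φ : ℝ) (Z : ℝ × ℝ × ℝ → ℂ) : Prop :=
  Measurable Z ∧
    TendstoInMeasure unif3 (fun (s : Finset ℤ) z => ∑ n ∈ s, seriesTerm ω φ n z) atTop Z

theorem continuous_e : Continuous e := by
  unfold e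
  fun_prop

theorem norm_e (x : ℝ) : ‖e x‖ = 1 := by
  have h : (2 * Real.pi * Complex.I * (x : ℂ)) = ((2 * Real.pi * x : ℝ) : ℂ) * Complex.I := by
    push_cast
    ring
  rw [e, h, Complex.norm_exp_ofReal_mul_I]

theorem e_add (x y : ℝ) : e (x + y) = e x * e y := by
  rw [e, e, e, ← Complex.exp_add]
  congr 1
  push_cast
  ring

theorem conj_e (x : ℝ) : starRingEnd ℂ (e x) = e (-x) := by
  rw [e, e, ← Complex.exp_conj]
  congr 1
  simp [Complex.conj_ofNat]

theorem integral_e_int (m : ℤ) (hm : m ≠ 0) : ∫ x, e (m * x) ∂unif = 0 := by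
  rw [unif, integral_Ico_eq_integral_Ioo, ← integral_Ioc_eq_integral_Ioo,
    ← intervalIntegral.integral_of_le zero_le_one]
  have hc : (2 * Real.pi * Complex.I * (m : ℂ)) ≠ 0 := by
    have : (m : ℂ) ≠ 0 := by exact_mod_cast hm
    simp [Real.pi_ne_zero, this]
  have h := integral_exp_mul_complex (a := 0) (b := 1) hc
  have h1 : Complex.exp (2 * Real.pi * Complex.I * (m : ℂ)) = 1 := by
    rw [Complex.exp_eq_one_iff]
    exact ⟨m, by ring⟩
  have h2 : (fun x : ℝ => e (m * x)) =
      fun x : ℝ => Complex.exp (2 * Real.pi * Complex.I * (m : ℂ) * x) := by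
    funext x
    rw [e]
    congr 1
    push_cast
    ring
  rw [h2, h]
  simp [h1]

theorem measurable_seriesTerm (ω φ : ℝ) (n : ℤ) : Measurable (seriesTerm ω φ n) := by
  have he : Measurable e := continuous_e.measurable
  unfold seriesTerm
  refine Measurable.mul (Measurable.div ?_ ?_) ?_
  · exact measurable_const.add (he.comp (by fun_prop))
  · exact measurable_const.sub (Complex.measurable_ofReal.comp (by fun_prop))
  · exact he.comp (by fun_prop)

theorem ae_unif3_mem : ∀ᵐ z ∂unif3, z.2.2 ∈ Set.Ico (0 : ℝ) 1 := by
  have h : ∀ᵐ y ∂unif, y ∈ Set.Ico (0 : ℝ) 1 := by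
    rw [unif]
    exact ae_restrict_mem measurableSet_Ico
  have h1 : Measure.QuasiMeasurePreserving (fun z : ℝ × ℝ × ℝ => z.2.2) unif3 unif :=
    Measure.quasiMeasurePreserving_snd.comp Measure.quasiMeasurePreserving_snd
  exact h1.ae h

/-- The terms of the series without those of index `0` and `1`, which are not
square integrable. -/
def seriesTail (ω φ : ℝ) (n : ℤ) (z : ℝ × ℝ × ℝ) : ℂ :=
  if n = 0 ∨ n = 1 then 0 else seriesTerm ω φ n z

theorem measurable_seriesTail (ω φ : ℝ) (n : ℤ) : Measurable (seriesTail ω φ n) := by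
  unfold seriesTail
  split_ifs
  · exact measurable_const
  · exact measurable_seriesTerm ω φ n

theorem norm_seriesTail_le (ω φ : ℝ) (n : ℤ) :
    ∀ᵐ z ∂unif3, ‖seriesTail ω φ n z‖ ≤ 4 / |(n : ℝ)| := by
  filter_upwards [ae_unif3_mem] with z hz
  rw [seriesTail]
  split_ifs with h
  · simp only [norm_zero]
    positivity
  have h0 : n ≠ 0 := fun h' => h (Or.inl h')
  have h1 : n ≠ 1 := fun h' => h (Or.inr h')
  have hn : 0 < |(n : ℝ)| := by
    rw [abs_pos]
    exact_mod_cast h0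
  have key : |(n : ℝ)| / 2 ≤ |(n : ℝ) - z.2.2| := by
    rcases lt_or_gt_of_ne h0 with h2 | h2
    · have h3 : (n : ℝ) < 0 := by exact_mod_cast h2
      rw [abs_of_neg h3, abs_of_neg (by linarith [hz.1])]
      linarith [hz.1]
    · have h3 : (2 : ℝ) ≤ n := by exact_mod_cast (by omega : (2 : ℤ) ≤ n)
      rw [abs_of_pos (by linarith), abs_of_pos (by linarith [hz.2])]
      linarith [hz.2]
  have hd : ‖((n : ℂ) - (z.2.2 : ℂ))‖ = |(n : ℝ) - z.2.2| := by
    rw [← Real.norm_eq_abs, ← Complex.norm_real]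
    push_cast
    rfl
  rw [seriesTerm, norm_mul, norm_div, norm_e, mul_one, hd]
  have hnum : ‖1 + e (z.1 - n * φ)‖ ≤ 2 := by
    refine (norm_add_le _ _).trans ?_
    rw [norm_e, norm_one]
    norm_num
  calc ‖1 + e (z.1 - n * φ)‖ / |(n : ℝ) - z.2.2| ≤ 2 / (|(n : ℝ)| / 2) := by
        gcongr
    _ = 4 / |(n : ℝ)| := by
        field_simp
        norm_num

theorem memLp_seriesTail (ω φ : ℝ) (n : ℤ) : MemLp (seriesTail ω φ n) 2 unif3 :=
  MemLp.of_bound (measurable_seriesTail ω φ n).aestronglyMeasurable _ (norm_seriesTail_le ω φ n)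

theorem integral_seriesTail_mul (ω φ : ℝ) {m n : ℤ} (hmn : m ≠ n) :
    ∫ z, seriesTail ω φ n z * starRingEnd ℂ (seriesTail ω φ m z) ∂unif3 = 0 := by
  by_cases hm : m = 0 ∨ m = 1
  · simp [seriesTail, hm]
  by_cases hn : n = 0 ∨ n = 1
  · simp [seriesTail, hn]
  have hint : Integrable (fun z => seriesTail ω φ n z * starRingEnd ℂ (seriesTail ω φ m z)) unif3 :=
    MemLp.integrable_mul (p := 2) (q := 2) (memLp_seriesTail ω φ n) (memLp_seriesTail ω φ m).star
  rw [unif3] at hint ⊢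
  rw [integral_prod _ hint]
  refine integral_eq_zero_of_ae ?_
  filter_upwards [hint.prod_right_ae] with t ht
  rw [integral_prod_symm _ ht]
  refine integral_eq_zero_of_ae (ae_of_all _ fun y => ?_)
  have h : ∀ x : ℝ, seriesTail ω φ n (t, x, y) * starRingEnd ℂ (seriesTail ω φ m (t, x, y)) =
      ((1 + e (t - n * φ)) / ((n : ℂ) - (y : ℂ)) * e (1 / 2 * ((n : ℝ) - y) ^ 2 * ω) *
        (starRingEnd ℂ ((1 + e (t - m * φ)) / ((m : ℂ) - (y : ℂ))) *
          e (-(1 / 2 * ((m : ℝ) - y) ^ 2 * ω)))) * e ((n - m : ℤ) * x) := by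
    intro x
    have h1 : (((n - m : ℤ) : ℝ) * x) = n * x + -(m * x) := by
      push_cast
      ring
    simp only [seriesTail, hm, hn, if_false, seriesTerm]
    rw [map_mul, conj_e, neg_add, e_add, e_add, h1, e_add]
    ring
  simp only [h]
  rw [integral_const_mul, integral_e_int _ (sub_ne_zero.2 hmn.symm), mul_zero]
  rfl

theorem summable_seriesTail (ω φ : ℝ) :
    Summable (fun n : ℤ => (memLp_seriesTail ω φ n).toLp (seriesTail ω φ n)) := by
  set f : ℤ → Lp ℂ 2 unif3 := fun n => (memLp_seriesTail ω φ n).toLp (seriesTail ω φ n) with hf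
  have horth : Pairwise fun m n : ℤ => inner ℂ (f m) (f n) = 0 := by
    intro m n hmn
    rw [L2.inner_def, ← integral_seriesTail_mul ω φ hmn]
    refine integral_congr_ae ?_
    filter_upwards [(memLp_seriesTail ω φ n).coeFn_toLp, (memLp_seriesTail ω φ m).coeFn_toLp] with z h1 h2
    simp only [hf]
    rw [h1, h2]
    rfl
  have hV : OrthogonalFamily ℂ (fun n : ℤ => (Submodule.span ℂ {f n} : Submodule ℂ (Lp ℂ 2 unif3)))
      fun n => (Submodule.span ℂ {f n}).subtypeₗᵢ := by
    refine OrthogonalFamily.of_pairwise fun m n hmn => ?_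
    change Submodule.span ℂ {f m} ⟂ Submodule.span ℂ {f n}
    rw [Submodule.isOrtho_span]
    rintro a rfl b rfl
    exact horth hmn
  have hs := hV.summable_iff_norm_sq_summable
    (fun n => ⟨f n, Submodule.mem_span_singleton_self _⟩)
  refine hs.2 ?_
  have hb : Summable fun n : ℤ => 16 * (1 / (n : ℝ) ^ 2) :=
    (Real.summable_one_div_int_pow.2 one_lt_two).mul_left 16
  refine Summable.of_nonneg_of_le (fun n => by positivity) (fun n => ?_) hb
  have hle : ‖f n‖ ≤ 4 / |(n : ℝ)| := by
    refine (Lp.norm_le_of_ae_bound (C := 4 / |(n : ℝ)|) (by positivity) ?_).trans ?_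
    · filter_upwards [norm_seriesTail_le ω φ n, (memLp_seriesTail ω φ n).coeFn_toLp] with z h1 h2
      simp only [hf]
      rw [h2]
      exact h1
    · simp [measureUnivNNReal]
  calc ‖f n‖ ^ 2 ≤ (4 / |(n : ℝ)|) ^ 2 := by gcongr
    _ = 16 * (1 / (n : ℝ) ^ 2) := by
        rw [div_pow, sq_abs]
        ring

theorem exists_isSeriesSum (ω φ : ℝ) : ∃ Z, IsSeriesSum ω φ Z := by
  obtain ⟨g, hg⟩ := summable_seriesTail ω φ
  have hsum : TendstoInMeasure unif3
      (fun (s : Finset ℤ) => ((∑ n ∈ s, (memLp_seriesTail ω φ n).toLp (seriesTail ω φ n) :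
        Lp ℂ 2 unif3) : ℝ × ℝ × ℝ → ℂ)) atTop g := tendstoInMeasure_of_tendsto_Lp hg
  obtain ⟨g', hg'm, hg'⟩ := (Lp.aestronglyMeasurable g).aemeasurable
  refine ⟨fun z => seriesTerm ω φ 0 z + seriesTerm ω φ 1 z + g' z,
    ((measurable_seriesTerm ω φ 0).add (measurable_seriesTerm ω φ 1)).add hg'm, ?_⟩
  have h2 : TendstoInMeasure unif3 (fun (s : Finset ℤ) z => ∑ n ∈ s, seriesTail ω φ n z) atTop g' := by
    refine hsum.congr (fun s => ?_) hg'
    have hall : ∀ᵐ z ∂unif3, ∀ n : ℤ,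
        ((memLp_seriesTail ω φ n).toLp (seriesTail ω φ n) : ℝ × ℝ × ℝ → ℂ) z = seriesTail ω φ n z :=
      ae_all_iff.2 fun n => (memLp_seriesTail ω φ n).coeFn_toLp
    filter_upwards [hall, Lp.coeFn_finsetSum s (fun n => (memLp_seriesTail ω φ n).toLp (seriesTail ω φ n))]
      with z hz hz2
    rw [hz2]
    simp [hz]
  intro ε hε
  refine (h2 ε hε).congr' ?_
  filter_upwards [eventually_ge_atTop ({0, 1} : Finset ℤ)] with s hs
  have key : ∀ z, ∑ n ∈ s, seriesTerm ω φ n z =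
      seriesTerm ω φ 0 z + seriesTerm ω φ 1 z + ∑ n ∈ s, seriesTail ω φ n z := by
    intro z
    rw [← Finset.sum_sdiff hs, ← Finset.sum_sdiff hs (f := fun n => seriesTail ω φ n z)]
    have h3 : ∑ n ∈ s \ {0, 1}, seriesTerm ω φ n z = ∑ n ∈ s \ {0, 1}, seriesTail ω φ n z := by
      refine Finset.sum_congr rfl fun n hn => ?_
      have : ¬(n = 0 ∨ n = 1) := by
        have := (Finset.mem_sdiff.1 hn).2
        simpa using this
      simp [seriesTail, this]
    rw [h3]
    simp [seriesTail]
    ring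
  simp only [key, edist_add_left]

/-- The sum of the random series, a random variable in `(t', x, y)`; any two sums agree almost
surely. -/
def seriesSum (ω φ : ℝ) : ℝ × ℝ × ℝ → ℂ := Classical.choose (exists_isSeriesSum ω φ)

theorem seriesSum_spec (ω φ : ℝ) : IsSeriesSum ω φ (seriesSum ω φ) :=
  Classical.choose_spec (exists_isSeriesSum ω φ)

/-- Uniqueness of the sum up to null sets: the law of `Y` below does not depend on the choice. -/
theorem IsSeriesSum.ae_eq {ω φ : ℝ} {Z Z' : ℝ × ℝ × ℝ → ℂ} (h : IsSeriesSum ω φ Z)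
    (h' : IsSeriesSum ω φ Z') : Z =ᵐ[unif3] Z' :=
  tendstoInMeasure_ae_unique h.2 h'.2

/-- The uniform law of `(t, (t', x, y))` on the unit cube `[0,1)⁴`. -/
def unif4 : ProbabilityMeasure (ℝ × ℝ × ℝ × ℝ) := ⟨unif.prod unif3, inferInstance⟩

/-- The random variable `Y_{ω,φ} = (e(t) / 2π) · |∑_{n ∈ ℤ} …|`. -/
def Y (ω φ : ℝ) (w : ℝ × ℝ × ℝ × ℝ) : ℂ :=
  e w.1 / (2 * Real.pi) * (‖seriesSum ω φ w.2‖ : ℂ)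

theorem measurable_Y (ω φ : ℝ) : Measurable (Y ω φ) := by
  have h := (seriesSum_spec ω φ).1
  have he : Measurable e := continuous_e.measurable
  unfold Y
  exact ((he.comp measurable_fst).div_const _).mul
    (Complex.measurable_ofReal.comp (h.comp measurable_snd).norm)

/-- The law `ν_{ω,φ}` of `Y_{ω,φ}`. -/
def nu (ω φ : ℝ) : ProbabilityMeasure ℂ := unif4.map (measurable_Y ω φ).aemeasurable

end SkewSums

end

noncomputable section

namespace SkewSums

/-! Averaging over `q` rotates the Birkhoff sum uniformly, so only the law of its modulus matters.
Accordingly `integral_rhoTilde` trades a test function `F` for the radial function `rotMean F`, and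
the point of the torus for one uniform frequency `s` in the quadratic sum `∑ e(ns + n(n-1)u/2)`.

Write `u = -d/c + δ`, where `N²|δ|` stays bounded. Cut the circle of frequencies into `c` arcs, `s =
-(db + y)/c` with `b` modulo `c` and `y ∈ [0,1)`, after a fixed translation of `s`. Completing the
square turns the dependence on `b` into a shift of the summation window for a `c`-periodic quadratic
phase (`norm_quadSum_eq`). Encoding `b` as `⌊cx⌋` makes the sum a step function of `x`, the
`profile`, and `integral_circleSum_eq` shows that no information on the modulus is lost.

The gain is that the Fourier coefficients of the profile in `x` are explicit
(`integral_e_mul_profile`): a normalised Gauss sum, times `1 - e(-w)` times a slowly modulated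
geometric sum at `w = (j-y)/c`, over `2πi(j-y)`. Two facts identify them. By `gauss_eq` the Gauss
sum has modulus `√c` and phase `e(aj²/(2c))` up to a phase affine in `j`, which is the origin of
`ω`. By summation by parts the other numerator is `e(N(j-y)/c)` times a phase free of `j`, minus
`1`, with an error of order `c/N` for fixed `y` (`norm_slow_sum_sub_le`); this is the origin of `φ`
and of the factor `1 + e(t'-nφ)`.

The uniform bound `O(1/|j-y|)` and Parseval allow truncation to finitely many frequencies
(`integral_norm_profile_sub_le`). A truncated Fourier sum agrees, up to a unimodular factor, a
translation of `x` and a vanishing error, with a truncation of the random series at `t' = Ny/c +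
const` (`exists_norm_coefSum_sub_trunc_le`). Since `N/c → ∞`, this fast phase becomes uniform and
independent of `y` (`tendsto_integral_phase`), which produces the separate variable `t'`. Finally
the truncation is removed from the random series, whose partial sums converge in probability
(`tendsto_integral_trunc`). -/

/-! ### Elementary properties of the exponential. -/

theorem e_zero : e 0 = 1 := by simp [e]

theorem e_int (m : ℤ) : e m = 1 := by
  rw [e, Complex.exp_eq_one_iff]
  exact ⟨m, by push_cast; ring⟩

theorem e_add_int (x : ℝ) (m : ℤ) : e (x + m) = e x := by
  rw [e_add, e_int, mul_one]

theorem e_eq_of_sub_eq_int {x y : ℝ} (m : ℤ) (h : x - y = m) : e x = e y := by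
  rw [← e_add_int y m, ← h]
  congr 1
  ring

theorem e_neg_mul (x : ℝ) : e (-x) * e x = 1 := by
  rw [← e_add, neg_add_cancel, e_zero]

theorem e_pow (x : ℝ) (n : ℕ) : e x ^ n = e (n * x) := by
  rw [e, e, ← Complex.exp_nat_mul]
  congr 1
  push_cast
  ring

theorem norm_e_sub_one_le (x : ℝ) : ‖e x - 1‖ ≤ 2 * Real.pi * |x| := by
  have h := Real.norm_exp_I_mul_ofReal_sub_one_le (x := 2 * Real.pi * x)
  have h1 : e x = Complex.exp (Complex.I * ((2 * Real.pi * x : ℝ) : ℂ)) := by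
    rw [e]
    congr 1
    push_cast
    ring
  rw [h1]
  refine h.trans ?_
  rw [Real.norm_eq_abs, abs_mul, abs_of_pos (by positivity)]

theorem e_eq_one_iff {x : ℝ} : e x = 1 ↔ ∃ m : ℤ, x = m := by
  rw [e, Complex.exp_eq_one_iff]
  refine exists_congr fun m => ?_
  have h : (2 * Real.pi * Complex.I : ℂ) ≠ 0 := by simp [Real.pi_ne_zero]
  constructor
  · intro h1
    rw [mul_comm] at h1
    exact_mod_cast mul_right_cancel₀ h h1
  · rintro rfl
    push_cast
    ring

theorem exists_eq_e_mul_norm (ζ : ℂ) : ∃ r : ℝ, ζ = e r * (‖ζ‖ : ℂ) := by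
  refine ⟨Complex.arg ζ / (2 * Real.pi), ?_⟩
  nth_rewrite 1 [← Complex.norm_mul_exp_arg_mul_I ζ]
  rw [mul_comm, e]
  congr 2
  have : (Real.pi : ℂ) ≠ 0 := by simp [Real.pi_ne_zero]
  push_cast
  field_simp

theorem toCircle_coe_eq (x : ℝ) : (AddCircle.toCircle (x : UnitAddCircle) : ℂ) = e x := by
  rw [AddCircle.toCircle_apply_mk, Circle.coe_exp, e]
  congr 1
  push_cast
  ring

/-! ### Reduction from the torus to one frequency and the modulus of a sum. -/

theorem integral_unif_eq {E : Type*} [NormedAddCommGroup E] [NormedSpace ℝ E] (f : ℝ → E) :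
    ∫ x, f x ∂unif = ∫ x in (0 : ℝ)..1, f x := by
  rw [unif, integral_Ico_eq_integral_Ioo, ← integral_Ioc_eq_integral_Ioo,
    ← intervalIntegral.integral_of_le zero_le_one]

theorem integral_circle_eq {E : Type*} [NormedAddCommGroup E] [NormedSpace ℝ E]
    (f : UnitAddCircle → E) : ∫ x, f x = ∫ x : ℝ, f x ∂unif := by
  have h := UnitAddCircle.intervalIntegral_preimage 0 f
  rw [zero_add] at h
  rw [integral_unif_eq, h]

theorem integral_unif_add_right {E : Type*} [NormedAddCommGroup E] [NormedSpace ℝ E] {f : ℝ → E}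
    (hf : Function.Periodic f 1) (r : ℝ) : ∫ x, f (x + r) ∂unif = ∫ x, f x ∂unif := by
  rw [integral_unif_eq, integral_unif_eq, intervalIntegral.integral_comp_add_right]
  have h := hf.intervalIntegral_add_eq r 0
  rw [zero_add] at h
  rw [zero_add, add_comm 1 r, h]

/-- The mean of `F` over the circle through `ζ` about the origin. -/
def rotMean (F : ℂ → ℝ) (ζ : ℂ) : ℝ := ∫ t, F (e t * (‖ζ‖ : ℂ)) ∂unif

/-- The argument of `ζ` is absorbed by translating the angle, so the mean depends on `‖ζ‖` alone. -/
theorem integral_toCircle_mul (F : ℂ → ℝ) (ζ : ℂ) :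
    ∫ q : UnitAddCircle, F (AddCircle.toCircle q * ζ) = rotMean F ζ := by
  obtain ⟨r, hr⟩ := exists_eq_e_mul_norm ζ
  rw [integral_circle_eq, rotMean]
  have hp : Function.Periodic (fun t => F (e t * (‖ζ‖ : ℂ))) 1 := fun t => by
    have h := e_add_int t 1
    rw [Int.cast_one] at h
    simp only [h]
  rw [← integral_unif_add_right hp r]
  congr 1
  funext t
  rw [toCircle_coe_eq, e_add, mul_assoc, ← hr]

theorem skew_iterate (α : ℝ) (n : ℕ) (z : Torus2) :
    (skew α)^[n] z = (z.1 + n • (α : UnitAddCircle),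
      z.2 + n • z.1 + n.choose 2 • (α : UnitAddCircle)) := by
  induction n with
  | zero => simp
  | succ n ih =>
    rw [Function.iterate_succ_apply', ih, skew]
    ext1
    · simp only [succ_nsmul]
      abel
    · simp only [succ_nsmul, Nat.choose_succ_succ' n 1, Nat.choose_one_right, add_nsmul]
      abel

/-- The quadratic exponential sum as a function on the circle. -/
def circleSum (N : ℕ) (u : ℝ) (p : UnitAddCircle) : ℂ :=
  ∑ n ∈ Finset.Icc 1 N, (AddCircle.toCircle (n • p + n.choose 2 • (u : UnitAddCircle)) : ℂ)

theorem continuous_circleSum (N : ℕ) (u : ℝ) : Continuous (circleSum N u) := by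
  unfold circleSum
  refine continuous_finsetSum _ fun n _ => ?_
  exact continuous_subtype_val.comp (AddCircle.continuous_toCircle.comp (by fun_prop))

theorem birkhoff_eq (N : ℕ) (α : ℝ) (k l : ℤ) (z : Torus2) :
    birkhoff N α k l z = AddCircle.toCircle (k • z.1 + l • z.2) *
      circleSum N (l * α) (l • z.1 + k • (α : UnitAddCircle)) := by
  rw [birkhoff, circleSum, Finset.mul_sum]
  refine Finset.sum_congr rfl fun n _ => ?_
  rw [harmonic, skew_iterate, ← Circle.coe_mul, ← AddCircle.toCircle_add]
  congr 2
  have h : ((l * α : ℝ) : UnitAddCircle) = l • (α : UnitAddCircle) := by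
    rw [← zsmul_eq_mul]
    rfl
  rw [h]
  simp only [smul_add, smul_comm k, smul_comm l]
  abel

/-- Since `l ≠ 0`, both `q ↦ kp + lq` and `p ↦ lp + kα` preserve Haar measure on the circle. The
first makes the prefactor in `birkhoff_eq` a uniform rotation; the second makes the linear frequency
uniform and removes `k`. -/
theorem integral_rhoTilde {F : ℂ → ℝ} (hF : Continuous F) {K : ℝ} (hK : ∀ ζ, |F ζ| ≤ K)
    (N : ℕ) (α : ℝ) (k : ℤ) {l : ℤ} (hl : l ≠ 0) :
    ∫ ζ, F ζ ∂(rhoTilde N α k l : Measure ℂ) = ∫ s : ℝ,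
      rotMean F (circleSum N (l * α) (s : UnitAddCircle) / (Real.sqrt (cN N (l * α)) : ℂ)) ∂unif := by
  set r : ℂ := (Real.sqrt (cN N (l * α)) : ℂ)
  have hprob : IsProbabilityMeasure (volume : Measure UnitAddCircle) := ⟨by simp⟩
  have h1 : ∫ ζ, F ζ ∂(rhoTilde N α k l : Measure ℂ) =
      ∫ z : Torus2, F (renormSum N α k l z) := by
    rw [rhoTilde, ProbabilityMeasure.toMeasure_map, integral_map
      (continuous_renormSum N α k l).measurable.aemeasurable hF.aestronglyMeasurable]
    rfl
  have hint : Integrable (fun z : Torus2 => F (renormSum N α k l z)) volume :=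
    Integrable.of_bound (hF.comp (continuous_renormSum N α k l)).aestronglyMeasurable K
      (ae_of_all _ fun z => hK _)
  rw [h1, Measure.volume_eq_prod, integral_prod _ hint]
  have h2 : ∀ p : UnitAddCircle, ∫ q : UnitAddCircle, F (renormSum N α k l (p, q)) =
      rotMean F (circleSum N (l * α) (l • p + k • (α : UnitAddCircle)) / r) := by
    intro p
    rw [← integral_toCircle_mul]
    have hmp : MeasurePreserving (fun q : UnitAddCircle => k • p + l • q) :=
      (measurePreserving_add_left volume (k • p)).comp (Measure.measurePreserving_zsmul volume hl)
    have hg : AEStronglyMeasurable (fun q : UnitAddCircle => F (AddCircle.toCircle q *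
        (circleSum N (l * α) (l • p + k • (α : UnitAddCircle)) / r))) volume :=
      (hF.comp ((continuous_subtype_val.comp AddCircle.continuous_toCircle).mul
        continuous_const)).aestronglyMeasurable
    rw [← hmp.map_eq] at hg
    nth_rewrite 2 [← hmp.map_eq]
    rw [integral_map hmp.measurable.aemeasurable hg]
    congr 1
    funext q
    rw [renormSum, birkhoff_eq, mul_div_assoc]
  simp only [h2]
  have hmp : MeasurePreserving (fun p : UnitAddCircle => l • p + k • (α : UnitAddCircle)) :=
      (measurePreserving_add_right volume (k • (α : UnitAddCircle))).comp
        (Measure.measurePreserving_zsmul volume hl)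
  have hcont : Continuous (rotMean F) := by
    refine continuous_of_dominated (bound := fun _ => K) (fun ζ => ?_) (fun ζ => ae_of_all _ fun t => hK _)
      (integrable_const _) (ae_of_all _ fun t => ?_)
    · exact (hF.comp (continuous_e.mul continuous_const)).aestronglyMeasurable
    · exact hF.comp (continuous_const.mul (Complex.continuous_ofReal.comp continuous_norm))
  have hg : AEStronglyMeasurable (fun p : UnitAddCircle =>
      rotMean F (circleSum N (l * α) p / r)) volume :=
    (hcont.comp ((continuous_circleSum N _).div_const r)).aestronglyMeasurable
  rw [← integral_circle_eq (fun s => rotMean F (circleSum N (l * α) s / r))]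
  rw [← hmp.map_eq] at hg
  nth_rewrite 2 [← hmp.map_eq]
  rw [integral_map hmp.measurable.aemeasurable hg]

/-! ### Sums over residues -/

theorem exists_zmod_lift {E : Type*} {c : ℕ} {h : ℤ → E} (hh : ∀ n g : ℤ, h (n + c * g) = h n) :
    ∃ H : ZMod c → E, ∀ n : ℤ, H n = h n := by
  refine ⟨fun z => h z.cast, fun n => ?_⟩
  change h ((n : ZMod c).cast) = h n
  rw [ZMod.coe_intCast, Int.emod_def, sub_eq_add_neg, ← mul_neg, hh]

theorem sum_range_eq_sum_zmod {E : Type*} [AddCommMonoid E] {c : ℕ} [NeZero c] (H : ZMod c → E) :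
    ∑ m ∈ Finset.range c, H m = ∑ z, H z := by
  refine Finset.sum_bij (fun m _ => (m : ZMod c)) (fun _ _ => Finset.mem_univ _) ?_ ?_
    (fun _ _ => rfl)
  · intro m hm n hn h
    have h1 := (ZMod.natCast_eq_natCast_iff' m n c).1 h
    rwa [Nat.mod_eq_of_lt (Finset.mem_range.1 hm), Nat.mod_eq_of_lt (Finset.mem_range.1 hn)] at h1
  · intro z _
    exact ⟨z.val, Finset.mem_range.2 (ZMod.val_lt z), ZMod.natCast_zmod_val z⟩

theorem sum_range_comp_mul {E : Type*} [AddCommMonoid E] {c : ℕ} [NeZero c] {h : ℤ → E}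
    (hh : ∀ n g : ℤ, h (n + c * g) = h n) {d : ℤ} (hd : IsUnit (d : ZMod c)) :
    ∑ b ∈ Finset.range c, h (d * b) = ∑ b ∈ Finset.range c, h b := by
  obtain ⟨H, hH⟩ := exists_zmod_lift hh
  obtain ⟨v, hv⟩ := hd
  simp only [← hH]
  push_cast
  rw [sum_range_eq_sum_zmod (fun z : ZMod c => H ((d : ZMod c) * z)), sum_range_eq_sum_zmod H, ← hv]
  exact Equiv.sum_comp (Units.mulLeft v) H

theorem sum_range_comp_add {E : Type*} [AddCommMonoid E] {c : ℕ} [NeZero c] {h : ℤ → E}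
    (hh : ∀ n g : ℤ, h (n + c * g) = h n) (t : ℤ) :
    ∑ b ∈ Finset.range c, h (b + t) = ∑ b ∈ Finset.range c, h b := by
  obtain ⟨H, hH⟩ := exists_zmod_lift hh
  simp only [← hH]
  push_cast
  rw [sum_range_eq_sum_zmod (fun z : ZMod c => H (z + (t : ZMod c))), sum_range_eq_sum_zmod H]
  exact Equiv.sum_comp (Equiv.addRight (t : ZMod c)) H

theorem sum_range_e_div {c : ℕ} [NeZero c] (n : ℤ) :
    ∑ b ∈ Finset.range c, e ((n : ℝ) * b / c) = if (c : ℤ) ∣ n then (c : ℂ) else 0 := by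
  have hc : (c : ℝ) ≠ 0 := by exact_mod_cast NeZero.ne c
  have h1 : ∀ b : ℕ, e ((n : ℝ) * b / c) = e (n / c) ^ b := fun b => by
    rw [e_pow]
    congr 1
    ring
  simp only [h1]
  split_ifs with h
  · obtain ⟨m, rfl⟩ := h
    have : e (((c * m : ℤ) : ℝ) / c) = 1 := by
      rw [← e_int m]
      congr 1
      push_cast
      field_simp
    simp only [this, one_pow, Finset.sum_const, Finset.card_range, nsmul_eq_mul, mul_one]
  · have hne : e (n / c) ≠ 1 := by
      intro h2
      obtain ⟨m, hm⟩ := e_eq_one_iff.1 h2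
      refine h ⟨m, ?_⟩
      rw [div_eq_iff hc] at hm
      rw [mul_comm]
      exact_mod_cast hm
    rw [geom_sum_eq hne, e_pow]
    have : e (c * (n / c)) = 1 := by
      rw [← e_int n]
      congr 1
      field_simp
    rw [this, sub_self, zero_div]

/-! ### Quadratic phases and Gauss sums -/

/-- The quadratic phase `e(-dn(n-c)/(2c))`, which is `c`-periodic in `n`. -/
def quad (c : ℕ) (d n : ℤ) : ℂ := e (-((d : ℝ) * n * (n - c)) / (2 * c))

theorem norm_quad (c : ℕ) (d n : ℤ) : ‖quad c d n‖ = 1 := norm_e _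

theorem quad_zero (c : ℕ) (d : ℤ) : quad c d 0 = 1 := by simp [quad, e_zero]

theorem quad_add {c : ℕ} [NeZero c] (d m n : ℤ) :
    quad c d (m + n) = quad c d m * quad c d n * e (-((d : ℝ) * m * n) / c) := by
  have hc : (c : ℝ) ≠ 0 := by exact_mod_cast NeZero.ne c
  rw [quad, quad, quad, ← e_add, ← e_add]
  congr 1
  push_cast
  field_simp
  ring

/-- The exponent changes by `-dng - dc·g(g-1)/2`, an integer because `g(g-1)` is even. The term `-c`
in `n - c` is what makes this work for both parities of `c`. -/
theorem quad_add_mul {c : ℕ} [NeZero c] (d n g : ℤ) : quad c d (n + c * g) = quad c d n := by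
  have hc : (c : ℝ) ≠ 0 := by exact_mod_cast NeZero.ne c
  have hev : Even (g * (g - 1)) := by
    rcases Int.even_or_odd g with h | h
    · exact h.mul_right _
    · exact (h.sub_odd odd_one).mul_left _
  obtain ⟨r, hr⟩ := hev
  have hr' : (g : ℝ) * (g - 1) = r + r := by exact_mod_cast hr
  rw [quad, quad]
  refine e_eq_of_sub_eq_int (-(d * n * g) - d * c * r) ?_
  push_cast
  field_simp
  linear_combination (-(d : ℝ) * c ^ 2) * hr'

theorem conj_quad_mul (c : ℕ) (d n : ℤ) : starRingEnd ℂ (quad c d n) * quad c d n = 1 := by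
  rw [quad, conj_e, e_neg_mul]

/-- The Gauss sum `∑_b quad(b) e(-jb/c)` over residues `b` modulo `c`. -/
def gauss (c : ℕ) (d j : ℤ) : ℂ :=
  ∑ b ∈ Finset.range c, quad c d b * e (-((j : ℝ) * b) / c)

theorem e_div_add_mul {c : ℕ} [NeZero c] (j n g : ℤ) :
    e (-((j : ℝ) * ((n + c * g : ℤ) : ℝ)) / c) = e (-((j : ℝ) * n) / c) := by
  have hc : (c : ℝ) ≠ 0 := by exact_mod_cast NeZero.ne c
  refine e_eq_of_sub_eq_int (-(j * g)) ?_
  push_cast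
  field_simp
  ring

/-- Completing the square: translating the summation index by `t` splits off `quad c d t` and leaves
the linear phase of frequency `dt`. -/
theorem gauss_mul {c : ℕ} [NeZero c] (d t : ℤ) :
    gauss c d (d * t) = starRingEnd ℂ (quad c d t) * gauss c d 0 := by
  have h0 : gauss c d 0 = ∑ b ∈ Finset.range c, quad c d (b + t) := by
    rw [sum_range_comp_add (quad_add_mul d) t, gauss]
    simp [e_zero]
  rw [h0, gauss, Finset.mul_sum]
  refine Finset.sum_congr rfl fun b _ => ?_
  have h1 : e (-(((d * t : ℤ) : ℝ) * b) / c) = e (-((d : ℝ) * b * t) / c) := by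
    congr 2
    push_cast
    ring
  rw [quad_add, h1]
  push_cast
  linear_combination (-(quad c d b * e (-((d : ℝ) * b * t) / c))) * conj_quad_mul c d t

theorem gauss_add_mul {c : ℕ} [NeZero c] (d j g : ℤ) : gauss c d (j + c * g) = gauss c d j := by
  rw [gauss, gauss]
  refine Finset.sum_congr rfl fun b _ => ?_
  congr 1
  have h := e_div_add_mul (c := c) b j g
  rw [mul_comm] at h
  push_cast at h ⊢
  rw [h, mul_comm]

/-- In the squared modulus, one factor is re-indexed by the variable of the other; the quadratic
phases in that variable cancel. Orthogonality of characters then keeps only `c ∣ dn`, that is `n =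
0`. -/
theorem norm_gauss_zero {c : ℕ} [NeZero c] {d : ℤ} (hd : IsUnit (d : ZMod c)) :
    ‖gauss c d 0‖ = Real.sqrt c := by
  have hG : gauss c d 0 = ∑ b ∈ Finset.range c, quad c d b := by simp [gauss, e_zero]
  have h1 : starRingEnd ℂ (gauss c d 0) * gauss c d 0 = c := by
    have h2 : ∀ b : ℕ, gauss c d 0 = ∑ n ∈ Finset.range c, quad c d (n + b) := fun b => by
      rw [sum_range_comp_add (quad_add_mul d) b, hG]
    calc starRingEnd ℂ (gauss c d 0) * gauss c d 0
        = ∑ b ∈ Finset.range c, ∑ n ∈ Finset.range c,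
            quad c d n * e (((-d * n : ℤ) : ℝ) * b / c) := by
          nth_rewrite 1 [hG]
          rw [map_sum, Finset.sum_mul]
          refine Finset.sum_congr rfl fun b _ => ?_
          rw [h2 b, Finset.mul_sum]
          refine Finset.sum_congr rfl fun n _ => ?_
          have h3 : e (((-d * n : ℤ) : ℝ) * b / c) = e (-((d : ℝ) * n * b) / c) := by
            congr 2
            push_cast
            ring
          rw [quad_add, h3]
          push_cast
          linear_combination (quad c d n * e (-((d : ℝ) * n * b) / c)) * conj_quad_mul c d b
      _ = ∑ n ∈ Finset.range c, quad c d n * if (c : ℤ) ∣ -d * n then (c : ℂ) else 0 := by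
          rw [Finset.sum_comm]
          refine Finset.sum_congr rfl fun n _ => ?_
          rw [← Finset.mul_sum, sum_range_e_div]
      _ = c := by
          rw [Finset.sum_eq_single 0]
          · simp [quad_zero]
          · intro n hn hn0
            rw [if_neg, mul_zero]
            intro h
            have h4 : ((d : ZMod c)) * n = 0 := by
              have := (ZMod.intCast_zmod_eq_zero_iff_dvd (-d * n) c).2 h
              push_cast at this
              rwa [neg_mul, neg_eq_zero] at this
            rw [hd.mul_right_eq_zero, ZMod.natCast_eq_zero_iff] at h4
            exact absurd (Nat.le_of_dvd (Nat.pos_of_ne_zero hn0) h4)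
              (not_le.2 (Finset.mem_range.1 hn))
          · intro h
            exact absurd (Finset.mem_range.2 (Nat.pos_of_ne_zero (NeZero.ne c))) h
  rw [mul_comm, Complex.mul_conj] at h1
  have h5 : Complex.normSq (gauss c d 0) = c := by exact_mod_cast h1
  rw [← h5, Complex.normSq_eq_norm_sq, Real.sqrt_sq (norm_nonneg _)]

/-- As `a` inverts `d` modulo `c`, the frequency `j` may be written `d(aj)` and the square
completed. Replacing `da` by `1 + cg` leaves a half-integral term `agj²/2`, which equals `agj/2`
modulo integers. The correction is therefore linear in `j` and can later be absorbed in a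
translation of `x`. -/
theorem gauss_eq {c : ℕ} [NeZero c] {d a g : ℤ} (h : d * a = 1 + c * g) (j : ℤ) :
    gauss c d j = e ((a : ℝ) * j ^ 2 / (2 * c) + j * ((a * g - d * a : ℤ) / 2)) * gauss c d 0 := by
  have hc : (c : ℝ) ≠ 0 := by exact_mod_cast NeZero.ne c
  have h1 : gauss c d j = gauss c d (d * (a * j)) := by
    have : d * (a * j) = j + c * (g * j) := by linear_combination j * h
    rw [this, gauss_add_mul]
  have hev : Even (j * (j - 1)) := by
    rcases Int.even_or_odd j with h | h
    · exact h.mul_right _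
    · exact (h.sub_odd odd_one).mul_left _
  obtain ⟨r, hr⟩ := hev
  have hr' : (j : ℝ) * (j - 1) = r + r := by exact_mod_cast hr
  have h' : (d : ℝ) * a = 1 + c * g := by exact_mod_cast h
  rw [h1, gauss_mul, quad, conj_e]
  congr 1
  refine e_eq_of_sub_eq_int (a * g * r) ?_
  push_cast
  field_simp
  linear_combination (a * g * c : ℝ) * hr' + (a * j ^ 2 : ℝ) * h'

theorem isUnit_of_mul_eq {c : ℕ} {d a g : ℤ} (h : d * a = 1 + c * g) : IsUnit (d : ZMod c) := by
  have : (d : ZMod c) * a = 1 := by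
    have h1 := congrArg (Int.cast : ℤ → ZMod c) h
    push_cast at h1
    simpa using h1
  exact IsUnit.of_mul_eq_one _ this

/-! ### Window sums and the profile. -/

theorem measurable_e : Measurable e := continuous_e.measurable

theorem ae_unif_mem : ∀ᵐ y ∂unif, y ∈ Set.Ico (0 : ℝ) 1 := by
  rw [unif]
  exact ae_restrict_mem measurableSet_Ico

theorem ae_unif_mem_Ioo : ∀ᵐ y ∂unif, y ∈ Set.Ioo (0 : ℝ) 1 := by
  rw [unif, ← Measure.restrict_congr_set (Ioo_ae_eq_Ico (a := (0 : ℝ)) (b := 1))]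
  exact ae_restrict_mem measurableSet_Ioo

theorem integral_unif_eq_sum {E : Type*} [NormedAddCommGroup E] [NormedSpace ℝ E] {g : ℝ → E}
    (hg : ∀ a b, IntervalIntegrable g volume a b) (c : ℕ) [NeZero c] :
    ∫ x, g x ∂unif = (c : ℝ)⁻¹ • ∑ b ∈ Finset.range c, ∫ v, g ((b + v) / c) ∂unif := by
  have hc : (c : ℝ) ≠ 0 := by exact_mod_cast NeZero.ne c
  have h1 : ∀ b : ℕ, ∫ v, g ((b + v) / c) ∂unif =
      (c : ℝ) • ∫ x in (b : ℝ) / c..((b + 1 : ℕ) : ℝ) / c, g x := by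
    intro b
    rw [integral_unif_eq]
    have h := intervalIntegral.integral_comp_add_div (a := 0) (b := 1) g hc ((b : ℝ) / c)
    simp only [zero_div, add_zero] at h
    push_cast
    rw [add_div, ← h]
    simp only [add_div]
  simp only [h1]
  rw [← Finset.smul_sum, smul_smul, inv_mul_cancel₀ hc, one_smul,
    intervalIntegral.sum_integral_adjacent_intervals (fun k _ => hg _ _), integral_unif_eq]
  simp [hc]

theorem integral_unif_neg {E : Type*} [NormedAddCommGroup E] [NormedSpace ℝ E] {f : ℝ → E}
    (hf : Function.Periodic f 1) : ∫ x, f (-x) ∂unif = ∫ x, f x ∂unif := by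
  rw [integral_unif_eq, integral_unif_eq, intervalIntegral.integral_comp_neg]
  have h := hf.intervalIntegral_add_eq (-1) 0
  simpa using h

/-- The slowly varying quadratic phase `e(δ n(n-1)/2)`. -/
def slow (δ : ℝ) (n : ℕ) : ℂ := e (δ * (n * (n - 1) / 2))

theorem norm_slow (δ : ℝ) (n : ℕ) : ‖slow δ n‖ = 1 := norm_e _

/-- The quadratic exponential sum over the window `b + 1, …, b + N`. -/
def windowSum (N c : ℕ) (d : ℤ) (δ : ℝ) (b : ℤ) (y : ℝ) : ℂ :=
  ∑ n ∈ Finset.Icc 1 N, quad c d (n + b) * slow δ n * e (-(n * y) / c)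

/-- The normalised window sums as a step function of the window, modulated by a linear phase. -/
def profile (N c : ℕ) (d : ℤ) (δ y x : ℝ) : ℂ :=
  e (y * Int.fract (c * x) / c) * windowSum N c d δ ⌊c * x⌋ y / (Real.sqrt c : ℂ)

theorem measurable_profile (N c : ℕ) (d : ℤ) (δ : ℝ) :
    Measurable fun z : ℝ × ℝ => profile N c d δ z.1 z.2 := by
  unfold profile windowSum
  have hfl : Measurable fun z : ℝ × ℝ => ⌊(c : ℝ) * z.2⌋ :=
    Int.measurable_floor.comp (by fun_prop)
  refine Measurable.div_const (Measurable.mul (measurable_e.comp ?_) ?_) _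
  · exact (measurable_fst.mul (measurable_fract.comp (by fun_prop))).div_const _
  · refine Finset.measurable_sum _ fun n _ => Measurable.mul (Measurable.mul_const ?_ _)
      (measurable_e.comp (by fun_prop))
    exact (measurable_of_countable fun b : ℤ => quad c d (n + b)).comp hfl

theorem measurable_profile_right (N c : ℕ) (d : ℤ) (δ y : ℝ) :
    Measurable (profile N c d δ y) := by
  have h : Measurable (Function.uncurry (profile N c d δ)) := measurable_profile N c d δ
  exact h.of_uncurry_left

theorem norm_windowSum_le (N c : ℕ) (d : ℤ) (δ : ℝ) (b : ℤ) (y : ℝ) :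
    ‖windowSum N c d δ b y‖ ≤ N := by
  refine (norm_sum_le _ _).trans ?_
  simp [norm_quad, norm_slow, norm_e]

theorem norm_profile_le (N : ℕ) {c : ℕ} [NeZero c] (d : ℤ) (δ y x : ℝ) :
    ‖profile N c d δ y x‖ ≤ N / Real.sqrt c := by
  rw [profile, norm_div, norm_mul, norm_e, one_mul, Complex.norm_real, Real.norm_eq_abs,
    abs_of_nonneg (Real.sqrt_nonneg _)]
  gcongr
  exact norm_windowSum_le ..

theorem profile_div {N c : ℕ} [NeZero c] {d : ℤ} {δ y v : ℝ} (b : ℤ) (hv : v ∈ Set.Ico (0 : ℝ) 1) :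
    profile N c d δ y ((b + v) / c) = e (y * v / c) * windowSum N c d δ b y / (Real.sqrt c : ℂ) := by
  have hc : (c : ℝ) ≠ 0 := by exact_mod_cast NeZero.ne c
  have h1 : (c : ℝ) * ((b + v) / c) = b + v := by field_simp
  have h2 : ⌊(b : ℝ) + v⌋ = b := by
    rw [Int.floor_intCast_add, Int.floor_eq_zero_iff.2 hv, add_zero]
  have h3 : Int.fract ((b : ℝ) + v) = v := by
    rw [Int.fract_intCast_add, Int.fract_eq_self.2 hv]
  rw [profile, h1, h2, h3]

/-- The quadratic exponential sum as a function of the linear frequency. -/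
def quadSum (N c : ℕ) (d : ℤ) (δ s : ℝ) : ℂ :=
  ∑ n ∈ Finset.Icc 1 N, quad c d n * slow δ n * e (n * s)

theorem quadSum_periodic (N c : ℕ) (d : ℤ) (δ : ℝ) : Function.Periodic (quadSum N c d δ) 1 := by
  intro s
  refine Finset.sum_congr rfl fun n _ => ?_
  congr 1
  refine e_eq_of_sub_eq_int n ?_
  push_cast
  ring

theorem continuous_quadSum (N c : ℕ) (d : ℤ) (δ : ℝ) : Continuous (quadSum N c d δ) := by
  unfold quadSum
  exact continuous_finsetSum _ fun n _ => continuous_const.mul (continuous_e.comp (by fun_prop))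

/-- The translation of `s` pays for replacing `n(n-1)` by the periodic choice `n(n-c)` in the
rational part of the phase. -/
theorem circleSum_coe (N : ℕ) {c : ℕ} [NeZero c] (d : ℤ) (δ s : ℝ) :
    circleSum N (-d / c + δ) (s : UnitAddCircle) =
      quadSum N c d δ (s + -((d : ℝ) * (c - 1) / (2 * c))) := by
  have hc : (c : ℝ) ≠ 0 := by exact_mod_cast NeZero.ne c
  refine Finset.sum_congr rfl fun n _ => ?_
  have h : n • (s : UnitAddCircle) + n.choose 2 • ((-d / c + δ : ℝ) : UnitAddCircle) =
      ((n * s + n * (n - 1) / 2 * (-d / c + δ) : ℝ) : UnitAddCircle) := by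
    rw [← Nat.cast_choose_two, ← nsmul_eq_mul, ← nsmul_eq_mul]
    rfl
  rw [h, toCircle_coe_eq, quad, slow, ← e_add, ← e_add]
  congr 1
  push_cast
  field_simp
  ring

/-- The linear phase `e(-dnb/c)` is exactly the bilinear defect in `quad_add`, so it moves the
window by `b` at the cost of the unimodular factor `quad c d b`. -/
theorem norm_quadSum_eq (N : ℕ) {c : ℕ} [NeZero c] (d b : ℤ) (δ y : ℝ) :
    ‖quadSum N c d δ (-((((d * b : ℤ) : ℝ) + y) / c))‖ = ‖windowSum N c d δ b y‖ := by
  have hc : (c : ℝ) ≠ 0 := by exact_mod_cast NeZero.ne c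
  have h : windowSum N c d δ b y =
      quad c d b * quadSum N c d δ (-((((d * b : ℤ) : ℝ) + y) / c)) := by
    rw [windowSum, quadSum, Finset.mul_sum]
    refine Finset.sum_congr rfl fun n _ => ?_
    have h1 : e (n * -((((d * b : ℤ) : ℝ) + y) / c)) =
        e (-((d : ℝ) * (n : ℤ) * b) / c) * e (-(n * y) / c) := by
      rw [← e_add]
      congr 1
      push_cast
      field_simp
      ring
    rw [h1, quad_add]
    ring
  rw [h, norm_mul, norm_quad, one_mul]

theorem norm_div_sqrt_eq (ζ ξ : ℂ) (c : ℕ) (h : ‖ζ‖ = ‖ξ‖) :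
    ‖ζ / (Real.sqrt c : ℂ)‖ = ‖ξ / (Real.sqrt c : ℂ)‖ := by
  rw [norm_div, norm_div, h]

/-- The window `b` carries the frequency `-(db + y)/c`. Multiplication by the unit `d` permutes the
residues, so averaging over windows is averaging over all `c` arcs. -/
theorem integral_profile_eq {Ψ : ℂ → ℝ} (hΨ : Continuous Ψ) {K : ℝ} (hK : ∀ ζ, |Ψ ζ| ≤ K)
    (hnorm : ∀ ζ ξ : ℂ, ‖ζ‖ = ‖ξ‖ → Ψ ζ = Ψ ξ) (N : ℕ) {c : ℕ} [NeZero c] {d : ℤ}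
    (hd : IsUnit (d : ZMod c)) (δ y : ℝ) :
    ∫ x, Ψ (profile N c d δ y x) ∂unif = (c : ℝ)⁻¹ • ∑ b ∈ Finset.range c,
      Ψ (quadSum N c d δ (-((((b : ℤ) : ℝ) + y) / c)) / (Real.sqrt c : ℂ)) := by
  have hmes : Measurable (fun x => Ψ (profile N c d δ y x)) :=
    hΨ.measurable.comp (measurable_profile_right N c d δ y)
  have hint : ∀ a b, IntervalIntegrable (fun x => Ψ (profile N c d δ y x)) volume a b := by
    intro a b
    rw [intervalIntegrable_iff]
    exact Measure.integrableOn_of_bounded (M := K) (by simp) hmes.aestronglyMeasurable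
      (ae_of_all _ fun x => hK _)
  rw [integral_unif_eq_sum hint c]
  congr 1
  rw [← sum_range_comp_mul (c := c)
    (h := fun m : ℤ => Ψ (quadSum N c d δ (-((m + y) / c)) / (Real.sqrt c : ℂ))) ?_ hd]
  · refine Finset.sum_congr rfl fun b _ => ?_
    have h4 : ∀ᵐ v ∂unif, Ψ (profile N c d δ y ((b + v) / c)) =
        Ψ (quadSum N c d δ (-((((d * b : ℤ) : ℝ) + y) / c)) / (Real.sqrt c : ℂ)) := by
      filter_upwards [ae_unif_mem] with v hv
      have h5 := profile_div (N := N) (c := c) (d := d) (δ := δ) (y := y) (b : ℤ) hv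
      rw [Int.cast_natCast] at h5
      rw [h5, mul_div_assoc]
      refine hnorm _ _ ?_
      rw [norm_mul, norm_e, one_mul]
      exact norm_div_sqrt_eq _ _ _ (norm_quadSum_eq N d b δ y).symm
    rw [integral_congr_ae h4]
    simp
  · intro n g
    have hc : (c : ℝ) ≠ 0 := by exact_mod_cast NeZero.ne c
    have h6 : -((((n + c * g : ℤ) : ℝ) + y) / c) + (g : ℤ) * 1 = -((n + y) / c) := by
      push_cast
      field_simp
      ring
    have h7 := ((quadSum_periodic N c d δ).int_mul g) (-((((n + c * g : ℤ) : ℝ) + y) / c))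
    rw [h6] at h7
    simp only [h7]

theorem integral_circleSum_eq {Ψ : ℂ → ℝ} (hΨ : Continuous Ψ) {K : ℝ} (hK : ∀ ζ, |Ψ ζ| ≤ K)
    (hnorm : ∀ ζ ξ : ℂ, ‖ζ‖ = ‖ξ‖ → Ψ ζ = Ψ ξ) (N : ℕ) {c : ℕ} [NeZero c] {d : ℤ}
    (hd : IsUnit (d : ZMod c)) (δ : ℝ) :
    ∫ s : ℝ, Ψ (circleSum N (-d / c + δ) (s : UnitAddCircle) / (Real.sqrt c : ℂ)) ∂unif =
      ∫ y, ∫ x, Ψ (profile N c d δ y x) ∂unif ∂unif := by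
  set f : ℝ → ℝ := fun s => Ψ (quadSum N c d δ s / (Real.sqrt c : ℂ)) with hf
  have hfc : Continuous f := hΨ.comp ((continuous_quadSum N c d δ).div_const _)
  have hfp : Function.Periodic f 1 := fun s => by simp only [hf, quadSum_periodic N c d δ s]
  have h1 : ∀ s : ℝ, Ψ (circleSum N (-d / c + δ) (s : UnitAddCircle) / (Real.sqrt c : ℂ)) =
      f (s + -((d : ℝ) * (c - 1) / (2 * c))) := fun s => by simp only [hf, circleSum_coe]
  simp only [h1]
  rw [integral_unif_add_right hfp, ← integral_unif_neg hfp,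
    integral_unif_eq_sum (g := fun s => f (-s))
      (fun a b => (hfc.comp continuous_neg).intervalIntegrable a b) c,
    ← integral_finsetSum, ← integral_smul]
  · congr 1
    funext y
    rw [integral_profile_eq hΨ hK hnorm N hd]
    rfl
  · intro b _
    refine Integrable.of_bound (C := K) ?_ (ae_of_all _ fun x => hK _)
    exact (hfc.comp (by fun_prop)).aestronglyMeasurable

/-! ### Summation by parts -/

theorem one_sub_e_mul_sum (k : ℕ → ℂ) (w : ℝ) (N : ℕ) :
    (1 - e (-w)) * ∑ n ∈ Finset.Icc 1 (N + 1), k n * e (n * w) =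
      k (N + 1) * e ((N + 1 : ℕ) * w) - k 1 -
        ∑ n ∈ Finset.Icc 1 N, (k (n + 1) - k n) * e (n * w) := by
  induction N with
  | zero =>
    have h := e_neg_mul w
    simp only [zero_add, Finset.Icc_self, Finset.sum_singleton, Nat.cast_one, one_mul]
    simp only [zero_lt_one, Finset.Icc_eq_empty_of_lt, Finset.sum_empty, sub_zero]
    linear_combination -k 1 * h
  | succ N ih =>
    rw [Finset.sum_Icc_succ_top (by omega), mul_add, ih, Finset.sum_Icc_succ_top (by omega)]
    have h : e (-w) * e ((N + 1 + 1 : ℕ) * w) = e ((N + 1 : ℕ) * w) := by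
      rw [← e_add]
      congr 1
      push_cast
      ring
    linear_combination -k (N + 1 + 1) * h

theorem norm_one_sub_e_mul_sum_le (k : ℕ → ℂ) (w : ℝ) (N : ℕ) :
    ‖(1 - e (-w)) * ∑ n ∈ Finset.Icc 1 (N + 1), k n * e (n * w)‖ ≤
      ‖k (N + 1)‖ + ‖k 1‖ + ∑ n ∈ Finset.Icc 1 N, ‖k (n + 1) - k n‖ := by
  rw [one_sub_e_mul_sum]
  refine (norm_sub_le _ _).trans (add_le_add ((norm_sub_le _ _).trans ?_) ?_)
  · rw [norm_mul, norm_e, mul_one]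
  · refine (norm_sum_le _ _).trans (le_of_eq ?_)
    simp [norm_e]

theorem slow_one (δ : ℝ) : slow δ 1 = 1 := by simp [slow, e_zero]

theorem slow_succ_sub (δ : ℝ) (n : ℕ) : slow δ (n + 1) - slow δ n = slow δ n * (e (δ * n) - 1) := by
  rw [mul_sub, mul_one, slow, slow, ← e_add]
  congr 2
  push_cast
  ring

theorem norm_slow_succ_sub_le {δ : ℝ} {n N : ℕ} (h : n ≤ N) :
    ‖slow δ (n + 1) - slow δ n‖ ≤ 2 * Real.pi * (|δ| * N) := by
  rw [slow_succ_sub, norm_mul, norm_slow, one_mul]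
  refine (norm_e_sub_one_le _).trans ?_
  rw [abs_mul, Nat.abs_cast]
  gcongr

/-- Needed for the second summation by parts; under `N²|δ| ≤ C` the bound is of order `N⁻²`. -/
theorem norm_slow_second_difference_le {δ : ℝ} {n N : ℕ} (h : n + 1 ≤ N) :
    ‖(slow δ (n + 1 + 1) - slow δ (n + 1)) - (slow δ (n + 1) - slow δ n)‖ ≤
      (2 * Real.pi * (|δ| * N)) ^ 2 + 2 * Real.pi * |δ| := by
  have h1 : (slow δ (n + 1 + 1) - slow δ (n + 1)) - (slow δ (n + 1) - slow δ n) =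
      (slow δ (n + 1) - slow δ n) * (e (δ * (n + 1 : ℕ)) - 1) +
        slow δ n * e (δ * n) * (e δ - 1) := by
    have h2 : e (δ * (n + 1 : ℕ)) = e (δ * n) * e δ := by
      rw [← e_add]
      congr 1
      push_cast
      ring
    rw [slow_succ_sub δ (n + 1), slow_succ_sub δ n, h2]
    have h3 := slow_succ_sub δ n
    linear_combination (e (δ * n) * e δ - 1) * h3
  rw [h1]
  refine (norm_add_le _ _).trans (add_le_add ?_ ?_)
  · rw [norm_mul, sq]
    refine mul_le_mul (norm_slow_succ_sub_le (by omega)) ?_ (norm_nonneg _) (by positivity)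
    refine (norm_e_sub_one_le _).trans ?_
    rw [abs_mul, Nat.abs_cast]
    gcongr
  · rw [norm_mul, norm_mul, norm_slow, norm_e, one_mul, one_mul]
    exact norm_e_sub_one_le _

/-- One summation by parts: two boundary terms of modulus `1`, and a total variation of `slow δ` of
at most `2πC`. -/
theorem norm_slow_sum_le {δ C : ℝ} {N : ℕ} (hN : 0 < N) (hC : (N : ℝ) ^ 2 * |δ| ≤ C) (w : ℝ) :
    ‖(1 - e (-w)) * ∑ n ∈ Finset.Icc 1 N, slow δ n * e (n * w)‖ ≤ 2 + 2 * Real.pi * C := by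
  obtain ⟨M, rfl⟩ := Nat.exists_eq_succ_of_ne_zero hN.ne'
  refine (norm_one_sub_e_mul_sum_le _ _ _).trans ?_
  rw [norm_slow, norm_slow]
  have h : ∑ n ∈ Finset.Icc 1 M, ‖slow δ (n + 1) - slow δ n‖ ≤
      ∑ n ∈ Finset.Icc 1 M, 2 * Real.pi * (|δ| * (M + 1 : ℕ)) :=
    Finset.sum_le_sum fun n hn => norm_slow_succ_sub_le (by
      have := (Finset.mem_Icc.1 hn).2
      omega)
  rw [Finset.sum_const, Nat.card_Icc, nsmul_eq_mul, Nat.add_sub_cancel] at h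
  have h1 : (M : ℝ) * (2 * Real.pi * (|δ| * (M + 1 : ℕ))) ≤ 2 * Real.pi * C := by
    calc (M : ℝ) * (2 * Real.pi * (|δ| * (M + 1 : ℕ)))
        ≤ ((M + 1 : ℕ) : ℝ) * (2 * Real.pi * (|δ| * (M + 1 : ℕ))) := by
          gcongr
          linarith
      _ = 2 * Real.pi * (((M + 1 : ℕ) : ℝ) ^ 2 * |δ|) := by ring
      _ ≤ 2 * Real.pi * C := by gcongr
  linarith

/-- The difference is the remainder of the first summation by parts. A further factor `1 - e(-w)`
permits a second one: its boundary terms give `4πC/N`, and the second differences give `(2πC +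
(2πC)²)/N`. -/
theorem norm_slow_sum_sub_le {δ C : ℝ} {N : ℕ} (hN : 0 < N) (hC : (N : ℝ) ^ 2 * |δ| ≤ C) (w : ℝ) :
    ‖1 - e (-w)‖ * ‖(1 - e (-w)) * ∑ n ∈ Finset.Icc 1 N, slow δ n * e (n * w) -
      (slow δ N * e (N * w) - 1)‖ ≤ (6 * Real.pi * C + (2 * Real.pi * C) ^ 2) / N := by
  have hN' : (0 : ℝ) < N := by exact_mod_cast hN
  have hC0 : 0 ≤ C := le_trans (by positivity) hC
  have hδ : |δ| * N ≤ C / N := by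
    rw [le_div_iff₀ hN']
    linarith [hC]
  have hδ2 : |δ| ≤ C / N ^ 2 := by
    rw [le_div_iff₀ (by positivity)]
    linarith [hC]
  obtain ⟨M, rfl⟩ := Nat.exists_eq_succ_of_ne_zero hN.ne'
  rw [Nat.succ_eq_add_one] at *
  rw [one_sub_e_mul_sum, slow_one, sub_sub_cancel_left, norm_neg, ← norm_mul]
  -- For `N = 1` the remainder is an empty sum; otherwise the second summation by parts runs over `M
  -- + 1` terms.
  rcases M with _ | M
  · simp
    positivity
  refine (norm_one_sub_e_mul_sum_le (fun n => slow δ (n + 1) - slow δ n) w M).trans ?_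
  have h : ∑ n ∈ Finset.Icc 1 M, ‖(slow δ (n + 1 + 1) - slow δ (n + 1)) -
      (slow δ (n + 1) - slow δ n)‖ ≤ ∑ n ∈ Finset.Icc 1 M,
        ((2 * Real.pi * (|δ| * (M + 1 + 1 : ℕ))) ^ 2 + 2 * Real.pi * |δ|) :=
    Finset.sum_le_sum fun n hn => norm_slow_second_difference_le (by
      have := (Finset.mem_Icc.1 hn).2
      omega)
  rw [Finset.sum_const, Nat.card_Icc, nsmul_eq_mul, Nat.add_sub_cancel] at h
  have h1 := norm_slow_succ_sub_le (δ := δ) (n := M + 1) (N := M + 1 + 1) (by omega)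
  have h2 := norm_slow_succ_sub_le (δ := δ) (n := 1) (N := M + 1 + 1) (by omega)
  have h3 : 2 * Real.pi * (|δ| * (M + 1 + 1 : ℕ)) ≤ 2 * Real.pi * (C / (M + 1 + 1 : ℕ)) := by
    gcongr
  have h4 : (M : ℝ) * ((2 * Real.pi * (|δ| * (M + 1 + 1 : ℕ))) ^ 2 + 2 * Real.pi * |δ|) ≤
      ((M + 1 + 1 : ℕ) : ℝ) * ((2 * Real.pi * (C / (M + 1 + 1 : ℕ))) ^ 2 +
        2 * Real.pi * (C / (M + 1 + 1 : ℕ) ^ 2)) := by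
    gcongr
    linarith
  have h5 : ((M + 1 + 1 : ℕ) : ℝ) * ((2 * Real.pi * (C / (M + 1 + 1 : ℕ))) ^ 2 +
        2 * Real.pi * (C / (M + 1 + 1 : ℕ) ^ 2)) =
      (2 * Real.pi * C + (2 * Real.pi * C) ^ 2) / (M + 1 + 1 : ℕ) := by
    field_simp
    ring
  have h6 : (6 * Real.pi * C + (2 * Real.pi * C) ^ 2) / (M + 1 + 1 : ℕ) =
      2 * Real.pi * (C / (M + 1 + 1 : ℕ)) + 2 * Real.pi * (C / (M + 1 + 1 : ℕ)) +
        (2 * Real.pi * C + (2 * Real.pi * C) ^ 2) / (M + 1 + 1 : ℕ) := by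
    ring
  linarith

theorem norm_one_sub_e_le (c : ℕ) (x : ℝ) : ‖1 - e (c * x)‖ ≤ c * ‖1 - e x‖ := by
  rw [← e_pow, ← mul_neg_geom_sum, norm_mul, mul_comm]
  gcongr
  refine (norm_sum_le _ _).trans ?_
  simp [norm_e]

/-! ### Fourier coefficients of the profile -/

/-- The Fourier coefficients of the profile. -/
def coef (N c : ℕ) (d : ℤ) (δ y : ℝ) (j : ℤ) : ℂ :=
  gauss c d j / (Real.sqrt c : ℂ) * (((1 - e (-((j - y) / c))) *
    ∑ n ∈ Finset.Icc 1 N, slow δ n * e (n * ((j - y) / c))) /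
      (2 * Real.pi * Complex.I * ((j - y : ℝ) : ℂ)))

theorem integral_e_neg_mul {w : ℝ} (hw : w ≠ 0) :
    ∫ v, e (-(w * v)) ∂unif = (1 - e (-w)) / (2 * Real.pi * Complex.I * (w : ℂ)) := by
  have hpi : (Real.pi : ℂ) ≠ 0 := by simp [Real.pi_ne_zero]
  have hw' : (w : ℂ) ≠ 0 := by exact_mod_cast hw
  have hc : -(2 * Real.pi * Complex.I * (w : ℂ)) ≠ 0 := by simp [Real.pi_ne_zero, hw]
  have h := integral_exp_mul_complex (a := 0) (b := 1) hc
  have h2 : (fun v : ℝ => e (-(w * v))) =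
      fun v : ℝ => Complex.exp (-(2 * Real.pi * Complex.I * (w : ℂ)) * v) := by
    funext v
    rw [e]
    congr 1
    push_cast
    ring
  rw [integral_unif_eq, h2, h]
  have h3 : Complex.exp (-(2 * Real.pi * Complex.I * (w : ℂ)) * ((1 : ℝ) : ℂ)) = e (-w) := by
    rw [e]
    congr 1
    push_cast
    ring
  rw [h3]
  simp only [Complex.ofReal_zero, mul_zero, Complex.exp_zero]
  rw [div_neg, ← neg_div, neg_sub]

/-- For each `n`, translating `b` by `n` modulo `c` separates the Gauss sum from the sum over `n`.
-/
theorem sum_e_mul_windowSum (N : ℕ) {c : ℕ} [NeZero c] (d j : ℤ) (δ y : ℝ) :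
    ∑ b ∈ Finset.range c, e (-((j : ℝ) * b) / c) * windowSum N c d δ b y =
      gauss c d j * ∑ n ∈ Finset.Icc 1 N, slow δ n * e (n * ((j - y) / c)) := by
  have h1 : ∀ n : ℕ, ∑ b ∈ Finset.range c, e (-((j : ℝ) * b) / c) * quad c d (n + b) =
      e ((j : ℝ) * n / c) * gauss c d j := by
    intro n
    have h2 := sum_range_comp_add (c := c)
      (h := fun m : ℤ => quad c d m * e (-((j : ℝ) * m) / c))
      (fun m g => by simp only [quad_add_mul, e_div_add_mul]) (n : ℤ)
    have h3 : gauss c d j = ∑ b ∈ Finset.range c,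
        quad c d ((b : ℤ) + n) * e (-((j : ℝ) * (((b : ℤ) + n : ℤ) : ℝ)) / c) := by
      rw [h2, gauss]
      simp
    rw [h3, Finset.mul_sum]
    refine Finset.sum_congr rfl fun b _ => ?_
    have h4 : e (-((j : ℝ) * b) / c) =
        e ((j : ℝ) * n / c) * e (-((j : ℝ) * (((b : ℤ) + n : ℤ) : ℝ)) / c) := by
      rw [← e_add]
      congr 1
      push_cast
      ring
    rw [h4, add_comm (n : ℤ)]
    ring
  simp only [windowSum, Finset.mul_sum]
  rw [Finset.sum_comm]
  refine Finset.sum_congr rfl fun n _ => ?_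
  have h5 : e (n * ((j - y) / c)) = e ((j : ℝ) * n / c) * e (-(n * y) / c) := by
    rw [← e_add]
    congr 1
    ring
  rw [h5]
  calc ∑ b ∈ Finset.range c, e (-((j : ℝ) * b) / c) *
        (quad c d (n + b) * slow δ n * e (-(n * y) / c))
      = (∑ b ∈ Finset.range c, e (-((j : ℝ) * b) / c) * quad c d (n + b)) *
          (slow δ n * e (-(n * y) / c)) := by
        rw [Finset.sum_mul]
        exact Finset.sum_congr rfl fun b _ => by ring
    _ = _ := by
        rw [h1]
        ring

/-- The modulation `e(y{cx}/c)` built into the profile turns the integral over each step into one of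
`e(-(j-y)v/c)`. This puts `j - y` rather than `j` in the denominator, and its factor `1 -
e(-(j-y)/c)` is the one required for summation by parts. -/
theorem integral_e_mul_profile (N : ℕ) {c : ℕ} [NeZero c] (d j : ℤ) (δ : ℝ) {y : ℝ}
    (hy : (j : ℝ) - y ≠ 0) :
    ∫ x, e (-(j * x)) * profile N c d δ y x ∂unif = coef N c d δ y j := by
  have hc : (c : ℝ) ≠ 0 := by exact_mod_cast NeZero.ne c
  have hmes : Measurable fun x : ℝ => e (-(j * x)) * profile N c d δ y x :=
    (measurable_e.comp (by fun_prop)).mul (measurable_profile_right N c d δ y)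
  have hint : ∀ a b, IntervalIntegrable (fun x : ℝ => e (-(j * x)) * profile N c d δ y x)
      volume a b := by
    intro a b
    rw [intervalIntegrable_iff]
    refine Measure.integrableOn_of_bounded (M := N / Real.sqrt c) (by simp)
      hmes.aestronglyMeasurable (ae_of_all _ fun x => ?_)
    rw [norm_mul, norm_e, one_mul]
    exact norm_profile_le ..
  rw [integral_unif_eq_sum hint c]
  have h1 : ∀ b : ℕ, ∫ v, e (-(j * ((b + v) / c))) * profile N c d δ y ((b + v) / c) ∂unif =
      e (-((j : ℝ) * b) / c) * windowSum N c d δ b y / (Real.sqrt c : ℂ) *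
        ∫ v, e (-((j - y) / c * v)) ∂unif := by
    intro b
    rw [← integral_const_mul]
    refine integral_congr_ae ?_
    filter_upwards [ae_unif_mem] with v hv
    have h5 := profile_div (N := N) (c := c) (d := d) (δ := δ) (y := y) (b : ℤ) hv
    rw [Int.cast_natCast] at h5
    have h6 : e (-(j * ((b + v) / c))) * e (y * v / c) =
        e (-((j : ℝ) * b) / c) * e (-((j - y) / c * v)) := by
      rw [← e_add, ← e_add]
      congr 1
      ring
    rw [h5]
    linear_combination (windowSum N c d δ b y / (Real.sqrt c : ℂ)) * h6
  simp only [h1]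
  rw [← Finset.sum_mul, ← Finset.sum_div, sum_e_mul_windowSum,
    integral_e_neg_mul (div_ne_zero hy hc), coef, Complex.real_smul]
  have hc' : (c : ℂ) ≠ 0 := by exact_mod_cast hc
  generalize ∑ n ∈ Finset.Icc 1 N, slow δ n * e (n * ((j - y) / c)) = T
  generalize e (-((j - y) / c)) = q
  push_cast
  field_simp

theorem norm_two_pi_I_mul (x : ℝ) :
    ‖(2 * Real.pi * Complex.I * (x : ℂ))‖ = 2 * Real.pi * |x| := by
  simp [abs_of_pos Real.pi_pos]

theorem norm_gauss_div {c : ℕ} [NeZero c] {d a g : ℤ} (h : d * a = 1 + c * g) (j : ℤ) :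
    ‖gauss c d j / (Real.sqrt c : ℂ)‖ = 1 := by
  have hc : (0 : ℝ) < c := by exact_mod_cast Nat.pos_of_ne_zero (NeZero.ne c)
  rw [gauss_eq h, norm_div, norm_mul, norm_e, one_mul, norm_gauss_zero (isUnit_of_mul_eq h),
    Complex.norm_real, Real.norm_eq_abs, abs_of_nonneg (Real.sqrt_nonneg _),
    div_self (Real.sqrt_pos.2 hc).ne']

theorem norm_coef_le {N c : ℕ} [NeZero c] {d a g : ℤ} (h : d * a = 1 + c * g) {δ C : ℝ}
    (hN : 0 < N) (hC : (N : ℝ) ^ 2 * |δ| ≤ C) {y : ℝ} {j : ℤ} (hy : (j : ℝ) - y ≠ 0) :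
    ‖coef N c d δ y j‖ ≤ (2 + 2 * Real.pi * C) / |j - y| := by
  have hC0 : 0 ≤ C := le_trans (by positivity) hC
  have hy' : 0 < |(j : ℝ) - y| := abs_pos.2 hy
  rw [coef, norm_mul, norm_gauss_div h, one_mul, norm_div, norm_two_pi_I_mul]
  refine div_le_div₀ (by positivity) (norm_slow_sum_le hN hC _) hy' ?_
  nlinarith [Real.pi_gt_three]

/-- The factor `‖1 - e(-w)‖` lost in `norm_slow_sum_sub_le` is at least `‖1 - e y‖/c` at `w =
(j-y)/c`, because `e(-cw) = e(y)`. Hence an error `1/N` becomes `c/N`, with a constant finite for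
each `y` in the open interval. -/
theorem norm_coef_sub_le {N c : ℕ} [NeZero c] {d a g : ℤ} (h : d * a = 1 + c * g) {δ C : ℝ}
    (hN : 0 < N) (hC : (N : ℝ) ^ 2 * |δ| ≤ C) {y : ℝ} (hy : y ∈ Set.Ioo (0 : ℝ) 1) (j : ℤ) :
    ‖coef N c d δ y j - gauss c d j / (Real.sqrt c : ℂ) *
      ((slow δ N * e (N * ((j - y) / c)) - 1) / (2 * Real.pi * Complex.I * ((j - y : ℝ) : ℂ)))‖ ≤
      (6 * Real.pi * C + (2 * Real.pi * C) ^ 2) / (‖1 - e y‖ * |j - y|) * (c / N) := by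
  have hN' : (0 : ℝ) < N := by exact_mod_cast hN
  have hc : (0 : ℝ) < c := by exact_mod_cast Nat.pos_of_ne_zero (NeZero.ne c)
  have hC0 : 0 ≤ C := le_trans (by positivity) hC
  have hint : ∀ m : ℤ, y ≠ m := by
    rintro m rfl
    have h1 : 0 < m := by exact_mod_cast hy.1
    have h2 : m < 1 := by exact_mod_cast hy.2
    omega
  have hyj : (j : ℝ) - y ≠ 0 := fun h1 => hint j (sub_eq_zero.1 h1).symm
  have hy' : 0 < |(j : ℝ) - y| := abs_pos.2 hyj
  have he : 0 < ‖1 - e y‖ := by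
    rw [norm_pos_iff, sub_ne_zero]
    intro h1
    obtain ⟨m, hm⟩ := e_eq_one_iff.1 h1.symm
    exact hint m hm
  have he' : ‖1 - e y‖ ≤ c * ‖1 - e (-((j - y) / c))‖ := by
    refine le_trans (le_of_eq ?_) (norm_one_sub_e_le c (-((j - y) / c)))
    congr 2
    refine e_eq_of_sub_eq_int j ?_
    field_simp
    ring
  rw [coef, ← mul_sub, norm_mul, norm_gauss_div h, one_mul, ← sub_div, norm_div, norm_two_pi_I_mul]
  set E := ‖(1 - e (-((j - y) / c))) * ∑ n ∈ Finset.Icc 1 N, slow δ n * e (n * ((j - y) / c)) -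
    (slow δ N * e (N * ((j - y) / c)) - 1)‖ with hE
  have hmain := norm_slow_sum_sub_le hN hC ((j - y) / c)
  rw [← hE] at hmain
  set A := 6 * Real.pi * C + (2 * Real.pi * C) ^ 2
  have hE0 : 0 ≤ E := norm_nonneg _
  have h2 : ‖1 - e y‖ * E ≤ A * (c / N) := by
    calc ‖1 - e y‖ * E ≤ c * ‖1 - e (-((j - y) / c))‖ * E := by gcongr
      _ ≤ c * (A / N) := by
        rw [mul_assoc]
        gcongr
      _ = A * (c / N) := by ring
  rw [div_mul_eq_mul_div, div_le_div_iff₀ (by positivity) (by positivity)]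
  have h3 : |(j : ℝ) - y| ≤ 2 * Real.pi * |(j : ℝ) - y| := by nlinarith [Real.pi_gt_three]
  calc E * (‖1 - e y‖ * |(j : ℝ) - y|) = (‖1 - e y‖ * E) * |(j : ℝ) - y| := by ring
    _ ≤ A * (c / N) * (2 * Real.pi * |(j : ℝ) - y|) := by gcongr

/-! ### Truncation of the Fourier series by Parseval. -/

/-- The Fourier sum of the profile over a finite set of frequencies. -/
def coefSum (N c : ℕ) (d : ℤ) (δ : ℝ) (s : Finset ℤ) (y x : ℝ) : ℂ :=
  ∑ j ∈ s, coef N c d δ y j * e (j * x)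

theorem fourierCoeffOn_eq_integral_unif (f : ℝ → ℂ) (j : ℤ) :
    fourierCoeffOn zero_lt_one f j = ∫ x, e (-(j * x)) * f x ∂unif := by
  rw [fourierCoeffOn_eq_integral, integral_unif_eq, sub_zero, div_one, one_smul]
  congr 1
  funext x
  rw [fourier_coe_apply, smul_eq_mul, e]
  congr 2
  push_cast
  ring

theorem hasSum_sq_norm_integral_e_mul {f : ℝ → ℂ} (hf : Measurable f) {B : ℝ}
    (hB : ∀ x, ‖f x‖ ≤ B) :
    HasSum (fun j : ℤ => ‖∫ x, e (-(j * x)) * f x ∂unif‖ ^ 2) (∫ x, ‖f x‖ ^ 2 ∂unif) := by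
  have h := hasSum_sq_fourierCoeffOn (f := f) zero_lt_one
    (MemLp.of_bound hf.aestronglyMeasurable B (ae_of_all _ hB))
  simp only [fourierCoeffOn_eq_integral_unif] at h
  rwa [sub_zero, inv_one, one_smul, ← integral_unif_eq] at h

theorem integrable_unif_of_bound {f : ℝ → ℂ} (hf : Measurable f) {B : ℝ} (hB : ∀ x, ‖f x‖ ≤ B) :
    Integrable f unif :=
  Integrable.of_bound hf.aestronglyMeasurable B (ae_of_all _ hB)

theorem measurable_coefSum_right (N c : ℕ) (d : ℤ) (δ : ℝ) (s : Finset ℤ) (y : ℝ) :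
    Measurable (coefSum N c d δ s y) := by
  unfold coefSum
  exact Finset.measurable_sum _ fun j _ => (measurable_e.comp (by fun_prop)).const_mul _

theorem norm_coefSum_le (N c : ℕ) (d : ℤ) (δ : ℝ) (s : Finset ℤ) (y x : ℝ) :
    ‖coefSum N c d δ s y x‖ ≤ ∑ j ∈ s, ‖coef N c d δ y j‖ := by
  refine (norm_sum_le _ _).trans (le_of_eq ?_)
  simp [norm_e]

theorem integral_e_mul_coefSum (N c : ℕ) (d : ℤ) (δ : ℝ) (s : Finset ℤ) (y : ℝ) (j : ℤ) :
    ∫ x, e (-(j * x)) * coefSum N c d δ s y x ∂unif = if j ∈ s then coef N c d δ y j else 0 := by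
  have h1 : ∀ x : ℝ, e (-(j * x)) * coefSum N c d δ s y x =
      ∑ i ∈ s, coef N c d δ y i * e ((i - j : ℤ) * x) := by
    intro x
    rw [coefSum, Finset.mul_sum]
    refine Finset.sum_congr rfl fun i _ => ?_
    have : e ((i - j : ℤ) * x) = e (-(j * x)) * e (i * x) := by
      rw [← e_add]
      congr 1
      push_cast
      ring
    rw [this]
    ring
  simp only [h1]
  rw [integral_finsetSum]
  · simp only [integral_const_mul]
    rw [← Finset.sum_ite_eq' s j (fun i => coef N c d δ y i)]
    refine Finset.sum_congr rfl fun i _ => ?_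
    split_ifs with hij
    · subst hij
      simp [e_zero]
    · rw [integral_e_int _ (sub_ne_zero.2 hij), mul_zero]
  · intro i _
    refine integrable_unif_of_bound ((measurable_e.comp (by fun_prop)).const_mul _)
      (B := ‖coef N c d δ y i‖) fun x => ?_
    rw [norm_mul, norm_e, mul_one]

theorem half_abs_le_abs_sub {y : ℝ} (hy : y ∈ Set.Ioo (0 : ℝ) 1) {n : ℤ} (h0 : n ≠ 0)
    (h1 : n ≠ 1) : |(n : ℝ)| / 2 ≤ |(n : ℝ) - y| := by
  rcases lt_or_gt_of_ne h0 with h2 | h2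
  · have h3 : (n : ℝ) < 0 := by exact_mod_cast h2
    rw [abs_of_neg h3, abs_of_neg (by linarith [hy.1])]
    linarith [hy.1]
  · have h3 : (2 : ℝ) ≤ n := by exact_mod_cast (by omega : (2 : ℤ) ≤ n)
    rw [abs_of_pos (by linarith), abs_of_pos (by linarith [hy.2])]
    linarith [hy.2]

theorem intCast_sub_ne_zero {y : ℝ} (hy : y ∈ Set.Ioo (0 : ℝ) 1) (j : ℤ) : (j : ℝ) - y ≠ 0 := by
  intro h
  have h' : (j : ℝ) = y := sub_eq_zero.1 h
  have h1 : 0 < j := by exact_mod_cast h' ▸ hy.1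
  have h2 : j < 1 := by exact_mod_cast h' ▸ hy.2
  omega

/-- The tail outside a finite set of the series `∑ 1/n²`. -/
def tailSq (s : Finset ℤ) : ℝ := ∑' j : ℤ, if j ∈ s then 0 else 1 / (j : ℝ) ^ 2

theorem summable_tailSq (s : Finset ℤ) :
    Summable fun j : ℤ => if j ∈ s then 0 else 1 / (j : ℝ) ^ 2 := by
  refine Summable.of_nonneg_of_le (fun j => ?_) (fun j => ?_)
    (Real.summable_one_div_int_pow.2 one_lt_two)
  · split_ifs <;> positivity
  · split_ifs
    · positivity
    · exact le_rfl

theorem tendsto_tailSq : Tendsto tailSq atTop (𝓝 0) := by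
  refine (tendsto_tsum_compl_atTop_zero (fun j : ℤ => 1 / (j : ℝ) ^ 2)).congr fun s => ?_
  refine (tsum_subtype {x | x ∉ s} (fun j : ℤ => 1 / (j : ℝ) ^ 2)).trans ?_
  refine tsum_congr fun j => ?_
  by_cases h : j ∈ s <;> simp [h]

/-- Parseval bounds the mean square by the coefficients outside `s`. Having `0` and `1` in `s`
excludes the two denominators `|j - y|` not comparable to `|j|`, so the bound is uniform in `N`,
`c`, `d` and `y`. -/
theorem integral_norm_profile_sub_le {N c : ℕ} [NeZero c] {d a g : ℤ} (h : d * a = 1 + c * g)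
    {δ C : ℝ} (hN : 0 < N) (hC : (N : ℝ) ^ 2 * |δ| ≤ C) {y : ℝ} (hy : y ∈ Set.Ioo (0 : ℝ) 1)
    {s : Finset ℤ} (h0 : 0 ∈ s) (h1 : 1 ∈ s) {η : ℝ} (hη : 0 < η) :
    ∫ x, ‖profile N c d δ y x - coefSum N c d δ s y x‖ ∂unif ≤
      η + (2 * (2 + 2 * Real.pi * C)) ^ 2 * tailSq s / η := by
  set B := 2 + 2 * Real.pi * C with hBdef
  have hC0 : 0 ≤ C := le_trans (by positivity) hC
  set f : ℝ → ℂ := fun x => profile N c d δ y x - coefSum N c d δ s y x with hf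
  have hfm : Measurable f :=
    (measurable_profile_right N c d δ y).sub (measurable_coefSum_right N c d δ s y)
  have hfb : ∀ x, ‖f x‖ ≤ N / Real.sqrt c + ∑ j ∈ s, ‖coef N c d δ y j‖ := fun x =>
    (norm_sub_le _ _).trans (add_le_add (norm_profile_le ..) (norm_coefSum_le ..))
  have hcoef : ∀ j : ℤ, ∫ x, e (-(j * x)) * f x ∂unif =
      if j ∈ s then 0 else coef N c d δ y j := by
    intro j
    have hme : Measurable fun x : ℝ => e (-(j * x)) := measurable_e.comp (by fun_prop)
    simp only [hf, mul_sub]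
    rw [integral_sub, integral_e_mul_profile N d j δ (intCast_sub_ne_zero hy j),
      integral_e_mul_coefSum]
    · split_ifs <;> simp
    · refine integrable_unif_of_bound (hme.mul (measurable_profile_right N c d δ y))
        (B := N / Real.sqrt c) fun x => ?_
      rw [norm_mul, norm_e, one_mul]
      exact norm_profile_le ..
    · refine integrable_unif_of_bound (hme.mul (measurable_coefSum_right N c d δ s y))
        (B := ∑ j ∈ s, ‖coef N c d δ y j‖) fun x => ?_
      rw [norm_mul, norm_e, one_mul]
      exact norm_coefSum_le ..
  have hpars := hasSum_sq_norm_integral_e_mul hfm hfb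
  simp only [hcoef] at hpars
  have hL2 : ∫ x, ‖f x‖ ^ 2 ∂unif ≤ (2 * B) ^ 2 * tailSq s := by
    rw [← hpars.tsum_eq, tailSq, ← tsum_mul_left]
    refine hpars.summable.tsum_le_tsum (fun j => ?_) ((summable_tailSq s).mul_left _)
    split_ifs with hj
    · simp
    · have hj0 : j ≠ 0 := fun h' => hj (h' ▸ h0)
      have hj1 : j ≠ 1 := fun h' => hj (h' ▸ h1)
      have hjpos : 0 < |(j : ℝ)| := abs_pos.2 (by exact_mod_cast hj0)
      have hle : ‖coef N c d δ y j‖ ≤ 2 * B / |(j : ℝ)| := by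
        refine (norm_coef_le h hN hC (intCast_sub_ne_zero hy j)).trans ?_
        calc B / |(j : ℝ) - y| ≤ B / (|(j : ℝ)| / 2) := by
              gcongr
              exact half_abs_le_abs_sub hy hj0 hj1
          _ = 2 * B / |(j : ℝ)| := by field_simp
      calc ‖coef N c d δ y j‖ ^ 2 ≤ (2 * B / |(j : ℝ)|) ^ 2 := by gcongr
        _ = (2 * B) ^ 2 * (1 / (j : ℝ) ^ 2) := by
          rw [div_pow, sq_abs]
          ring
  have hsq : Integrable (fun x => ‖f x‖ ^ 2) unif :=
    Integrable.of_bound (hfm.norm.pow_const 2).aestronglyMeasurable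
      ((N / Real.sqrt c + ∑ j ∈ s, ‖coef N c d δ y j‖) ^ 2) (ae_of_all _ fun x => by
        rw [Real.norm_eq_abs, abs_of_nonneg (by positivity)]
        gcongr
        exact hfb x)
  -- The inequality `r ≤ η + r²/η` passes from mean square to mean modulus; `η` is chosen later.
  calc ∫ x, ‖f x‖ ∂unif ≤ ∫ x, (η + ‖f x‖ ^ 2 / η) ∂unif := by
        refine integral_mono (integrable_unif_of_bound hfm hfb).norm
          ((integrable_const _).add (hsq.div_const _)) fun x => ?_
        change ‖f x‖ ≤ η + ‖f x‖ ^ 2 / η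
        rw [← sub_le_iff_le_add', le_div_iff₀ hη]
        nlinarith [sq_nonneg (‖f x‖ - η), norm_nonneg (f x)]
    _ = η + (∫ x, ‖f x‖ ^ 2 ∂unif) / η := by
        rw [integral_add (integrable_const _) (hsq.div_const _), integral_div]
        simp
    _ ≤ _ := by gcongr

/-! ### Equidistribution of a fast phase -/

theorem unif_eq_restrict_Ioo : unif = volume.restrict (Set.Ioo (0 : ℝ) 1) := by
  rw [unif, ← Measure.restrict_congr_set (Ioo_ae_eq_Ico (a := (0 : ℝ)) (b := 1))]

/-- Lebesgue measure on `[-1, 1]`. -/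
def slab : Measure ℝ := volume.restrict (Set.Icc (-1) 1)

instance : IsFiniteMeasure slab := by unfold slab; infer_instance

theorem integral_slab_eq {f : ℝ → ℝ} (hf : ∀ y, y ∉ Set.Ioo (-1 : ℝ) 1 → f y = 0) :
    ∫ y, f y ∂slab = ∫ y, f y := by
  rw [slab]
  refine setIntegral_eq_integral_of_forall_compl_eq_zero fun y hy => hf y fun h => hy ?_
  exact Set.Ioo_subset_Icc_self h

theorem integral_slab_indicator (f : ℝ → ℝ) :
    ∫ y, (Set.Ioo (0 : ℝ) 1).indicator f y ∂slab = ∫ y, f y ∂unif := by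
  rw [integral_slab_eq, integral_indicator measurableSet_Ioo, unif_eq_restrict_Ioo]
  intro y hy
  exact Set.indicator_of_notMem (fun h => hy ⟨by linarith [h.1], h.2⟩) _

section Equidistribution

variable {A : ℝ → ℝ → ℝ} {K : ℝ}

theorem measurable_indicator_uncurry (hA : Measurable (Function.uncurry A)) :
    Measurable fun z : ℝ × ℝ => (Set.Ioo (0 : ℝ) 1).indicator (A z.1) z.2 := by
  have h : (fun z : ℝ × ℝ => (Set.Ioo (0 : ℝ) 1).indicator (A z.1) z.2) =
      (Prod.snd ⁻¹' Set.Ioo (0 : ℝ) 1).indicator (Function.uncurry A) := by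
    funext z
    simp [Set.indicator, Function.uncurry]
  rw [h]
  exact hA.indicator (measurable_snd measurableSet_Ioo)

theorem abs_indicator_le (hK : ∀ t y, |A t y| ≤ K) (t y : ℝ) :
    |(Set.Ioo (0 : ℝ) 1).indicator (A t) y| ≤ K := by
  rw [Set.indicator]
  split_ifs
  · exact hK t y
  · rw [abs_zero]
    exact (abs_nonneg _).trans (hK t y)

/-- Here `My + κ + τ = M(y + τ/M) + κ`, so translation invariance on the line removes `τ`. For `M ≥
1` the translated interval still lies in `[-1, 1]`, so integrating over that slab loses nothing. -/
theorem integral_shifted_phase (hA : Measurable (Function.uncurry A)) (hK : ∀ t y, |A t y| ≤ K)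
    {M : ℝ} (hM : 1 ≤ M) (κ : ℝ) :
    ∫ z : ℝ × ℝ, (Set.Ioo (0 : ℝ) 1).indicator (A (M * z.2 + κ + z.1)) (z.2 + z.1 / M)
      ∂(unif.prod slab) = ∫ y, A (M * y + κ) y ∂unif := by
  have hM0 : M ≠ 0 := by positivity
  rw [integral_prod]
  · have h : ∀ᵐ τ ∂unif, ∫ y, (Set.Ioo (0 : ℝ) 1).indicator (A (M * y + κ + τ)) (y + τ / M) ∂slab =
        ∫ y, A (M * y + κ) y ∂unif := by
      filter_upwards [ae_unif_mem] with τ hτ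
      have hτM : τ / M < 1 := by
        rw [div_lt_one (by linarith)]
        linarith [hτ.2]
      have hτM0 : 0 ≤ τ / M := div_nonneg hτ.1 (by linarith)
      rw [integral_slab_eq]
      · have h1 : ∀ y, (Set.Ioo (0 : ℝ) 1).indicator (A (M * y + κ + τ)) (y + τ / M) =
            (fun y => (Set.Ioo (0 : ℝ) 1).indicator (fun y => A (M * y + κ) y) y) (y + τ / M) := by
          intro y
          simp only [Set.indicator]
          congr 2
          field_simp
          ring
        simp only [h1]
        rw [integral_add_right_eq_self
          (fun y => (Set.Ioo (0 : ℝ) 1).indicator (fun y => A (M * y + κ) y) y),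
          integral_indicator measurableSet_Ioo, unif_eq_restrict_Ioo]
      · intro y hy
        refine Set.indicator_of_notMem (fun h => hy ⟨?_, ?_⟩) _
        · linarith [h.1]
        · linarith [h.2]
    rw [integral_congr_ae h]
    simp
  · refine Integrable.of_bound (C := K) ?_ (ae_of_all _ fun z => abs_indicator_le hK _ _)
    have hg : Measurable fun z : ℝ × ℝ => (M * z.2 + κ + z.1, z.2 + z.1 / M) := by fun_prop
    exact ((measurable_indicator_uncurry hA).comp hg).aestronglyMeasurable

/-- With the second argument left at `y`, averaging `τ` over a full period erases the offset `My +
κ`. -/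
theorem integral_phase (hA : Measurable (Function.uncurry A)) (hK : ∀ t y, |A t y| ≤ K)
    (hper : ∀ y, Function.Periodic (fun t => A t y) 1) (M κ : ℝ) :
    ∫ z : ℝ × ℝ, (Set.Ioo (0 : ℝ) 1).indicator (A (M * z.2 + κ + z.1)) z.2
      ∂(unif.prod slab) = ∫ t, ∫ y, A t y ∂unif ∂unif := by
  have hB := measurable_indicator_uncurry hA
  have hg : Measurable fun z : ℝ × ℝ => (M * z.2 + κ + z.1, z.2) := by fun_prop
  have hi1 : Integrable (fun z : ℝ × ℝ => (Set.Ioo (0 : ℝ) 1).indicator (A (M * z.2 + κ + z.1)) z.2)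
      (unif.prod slab) :=
    Integrable.of_bound (C := K) (hB.comp hg).aestronglyMeasurable
      (ae_of_all _ fun z => abs_indicator_le hK _ _)
  have hi2 : Integrable (fun z : ℝ × ℝ => (Set.Ioo (0 : ℝ) 1).indicator (A z.1) z.2)
      (unif.prod slab) :=
    Integrable.of_bound (C := K) hB.aestronglyMeasurable
      (ae_of_all _ fun z => abs_indicator_le hK _ _)
  have h1 : ∀ t, ∫ y, A t y ∂unif = ∫ y, (Set.Ioo (0 : ℝ) 1).indicator (A t) y ∂slab := fun t =>
    (integral_slab_indicator _).symm
  simp only [h1]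
  rw [← integral_prod (fun z : ℝ × ℝ => (Set.Ioo (0 : ℝ) 1).indicator (A z.1) z.2) hi2,
    integral_prod_symm _ hi1, integral_prod_symm _ hi2]
  congr 1
  funext y
  have hp : Function.Periodic (fun t => (Set.Ioo (0 : ℝ) 1).indicator (A t) y) 1 := by
    intro t
    simp only [Set.indicator]
    have h := hper y t
    dsimp only at h
    rw [h]
  rw [← integral_unif_add_right hp (M * y + κ)]
  simp only [add_comm]

/-- The two preceding integrals differ only in the slow argument, `y + τ/M` against `y`. A modulus
of continuity in `y` that is uniform in `t` makes their difference vanish, however fast the phase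
is. -/
theorem tendsto_integral_phase (hA : Measurable (Function.uncurry A)) (hK : ∀ t y, |A t y| ≤ K)
    (hper : ∀ y, Function.Periodic (fun t => A t y) 1)
    (hcont : ∀ y ∈ Set.Ioo (0 : ℝ) 1, ∃ m : ℝ → ℝ, Tendsto m (𝓝 y) (𝓝 0) ∧
      ∀ t y', |A t y' - A t y| ≤ m y')
    {M κ : ℕ → ℝ} (hM : Tendsto M atTop atTop) :
    Tendsto (fun i => ∫ y, A (M i * y + κ i) y ∂unif) atTop (𝓝 (∫ t, ∫ y, A t y ∂unif ∂unif)) := by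
  have hB := measurable_indicator_uncurry hA
  have hg1 : ∀ i, Measurable fun z : ℝ × ℝ => (M i * z.2 + κ i + z.1, z.2 + z.1 / M i) :=
    fun i => by fun_prop
  have hg2 : ∀ i, Measurable fun z : ℝ × ℝ => (M i * z.2 + κ i + z.1, z.2) := fun i => by fun_prop
  have hi1 : ∀ i, Integrable (fun z : ℝ × ℝ => (Set.Ioo (0 : ℝ) 1).indicator
      (A (M i * z.2 + κ i + z.1)) (z.2 + z.1 / M i)) (unif.prod slab) := fun i =>
    Integrable.of_bound (C := K) (hB.comp (hg1 i)).aestronglyMeasurable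
      (ae_of_all _ fun z => abs_indicator_le hK _ _)
  have hi2 : ∀ i, Integrable (fun z : ℝ × ℝ => (Set.Ioo (0 : ℝ) 1).indicator
      (A (M i * z.2 + κ i + z.1)) z.2) (unif.prod slab) := fun i =>
    Integrable.of_bound (C := K) (hB.comp (hg2 i)).aestronglyMeasurable
      (ae_of_all _ fun z => abs_indicator_le hK _ _)
  -- The cut-off jumps at `0` and `1`; these slow arguments form null sets.
  have hne : ∀ r : ℝ, ∀ᵐ z ∂(unif.prod slab), z.2 ≠ r := fun r => by
    have h : ∀ᵐ y ∂slab, y ≠ r :=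
      ae_restrict_of_ae (Measure.ae_ne volume r)
    exact Measure.quasiMeasurePreserving_snd.ae h
  have hτ : ∀ᵐ z ∂(unif.prod slab), z.1 ∈ Set.Ico (0 : ℝ) 1 :=
    Measure.quasiMeasurePreserving_fst.ae ae_unif_mem
  have hdiff : Tendsto (fun i => ∫ z : ℝ × ℝ, ((Set.Ioo (0 : ℝ) 1).indicator
      (A (M i * z.2 + κ i + z.1)) (z.2 + z.1 / M i) - (Set.Ioo (0 : ℝ) 1).indicator
      (A (M i * z.2 + κ i + z.1)) z.2) ∂(unif.prod slab)) atTop (𝓝 (∫ _ : ℝ × ℝ, (0 : ℝ)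
        ∂(unif.prod slab))) := by
    refine tendsto_integral_of_dominated_convergence (fun _ => K + K)
      (fun i => ((hi1 i).sub (hi2 i)).aestronglyMeasurable) (integrable_const _)
      (fun i => ae_of_all _ fun z => (norm_sub_le _ _).trans
        (add_le_add (abs_indicator_le hK _ _) (abs_indicator_le hK _ _))) ?_
    filter_upwards [hne 0, hne 1, hτ] with z h0 h1 hz
    have hlim : Tendsto (fun i => z.2 + z.1 / M i) atTop (𝓝 z.2) := by
      have := (tendsto_const_nhds (x := z.1)).div_atTop hM
      simpa using this.const_add z.2
    by_cases hz2 : z.2 ∈ Set.Ioo (0 : ℝ) 1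
    · obtain ⟨m, hm, hm'⟩ := hcont z.2 hz2
      refine squeeze_zero_norm' ?_ (hm.comp hlim)
      filter_upwards [hlim.eventually (isOpen_Ioo.mem_nhds hz2)] with i hi
      rw [Set.indicator_of_mem (show z.2 + z.1 / M i ∈ Set.Ioo (0 : ℝ) 1 from hi), Set.indicator_of_mem hz2]
      exact hm' _ _
    · have hz3 : z.2 ∈ (Set.Icc (0 : ℝ) 1)ᶜ := fun h =>
        hz2 ⟨lt_of_le_of_ne h.1 (Ne.symm h0), lt_of_le_of_ne h.2 h1⟩
      refine tendsto_const_nhds.congr' ?_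
      filter_upwards [hlim.eventually (isClosed_Icc.isOpen_compl.mem_nhds hz3)] with i hi
      rw [Set.indicator_of_notMem hz2,
        Set.indicator_of_notMem fun h => hi (Set.Ioo_subset_Icc_self h), sub_zero]
  rw [integral_zero] at hdiff
  have h2 := hdiff.add_const (∫ t, ∫ y, A t y ∂unif ∂unif)
  rw [zero_add] at h2
  refine h2.congr' ?_
  filter_upwards [hM.eventually_ge_atTop 1] with i hi
  rw [integral_sub (hi1 i) (hi2 i), integral_shifted_phase hA hK hi, integral_phase hA hK hper,
    sub_add_cancel]

end Equidistribution

/-! ### Truncations of the random series -/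

/-- The part of the `n`-th term of the random series that depends on `y`. -/
def termAmp (ω : ℝ) (n : ℤ) (y : ℝ) : ℂ := e (1 / 2 * ((n : ℝ) - y) ^ 2 * ω) / ((n : ℂ) - (y : ℂ))

/-- The truncation of the random series to a finite set of indices, divided by `2π`. -/
def trunc (ω φ : ℝ) (s : Finset ℤ) (z : ℝ × ℝ × ℝ) : ℂ :=
  (∑ n ∈ s, seriesTerm ω φ n z) / (2 * Real.pi)

/-- A bound for the distance of two truncations with different parameters. -/
def truncDist (ω φ ω' φ' : ℝ) (s : Finset ℤ) (y y' : ℝ) : ℝ :=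
  ∑ n ∈ s, (‖e (-(n * φ)) - e (-(n * φ'))‖ * ‖termAmp ω n y‖ +
    2 * ‖termAmp ω n y - termAmp ω' n y'‖)

theorem seriesTerm_eq (ω φ : ℝ) (n : ℤ) (t x y : ℝ) :
    seriesTerm ω φ n (t, x, y) = (1 + e t * e (-(n * φ))) * e (n * x) * termAmp ω n y := by
  rw [seriesTerm, termAmp, e_add, sub_eq_add_neg t, e_add]
  ring

theorem norm_seriesTerm_sub_le (ω φ ω' φ' : ℝ) (n : ℤ) (t x y y' : ℝ) :
    ‖seriesTerm ω φ n (t, x, y) - seriesTerm ω' φ' n (t, x, y')‖ ≤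
      ‖e (-(n * φ)) - e (-(n * φ'))‖ * ‖termAmp ω n y‖ +
        2 * ‖termAmp ω n y - termAmp ω' n y'‖ := by
  have h : seriesTerm ω φ n (t, x, y) - seriesTerm ω' φ' n (t, x, y') =
      e t * e (n * x) * ((e (-(n * φ)) - e (-(n * φ'))) * termAmp ω n y) +
        (1 + e t * e (-(n * φ'))) * (e (n * x) * (termAmp ω n y - termAmp ω' n y')) := by
    rw [seriesTerm_eq, seriesTerm_eq]
    ring
  rw [h]
  refine (norm_add_le _ _).trans (add_le_add ?_ ?_)
  · rw [norm_mul, norm_mul, norm_e, norm_e, one_mul, one_mul, norm_mul]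
  · rw [norm_mul, norm_mul, norm_e, one_mul]
    gcongr
    refine (norm_add_le _ _).trans ?_
    rw [norm_one, norm_mul, norm_e, norm_e]
    norm_num

theorem norm_trunc_sub_le (ω φ ω' φ' : ℝ) (s : Finset ℤ) (t x y y' : ℝ) :
    ‖trunc ω φ s (t, x, y) - trunc ω' φ' s (t, x, y')‖ ≤ truncDist ω φ ω' φ' s y y' := by
  have h : ‖(2 * Real.pi : ℂ)‖ = 2 * Real.pi := by simp [abs_of_pos Real.pi_pos]
  rw [trunc, trunc, ← sub_div, ← Finset.sum_sub_distrib, norm_div, h]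
  refine (div_le_self (norm_nonneg _) (by linarith [Real.pi_gt_three])).trans ?_
  exact norm_sum_le_of_le _ fun n _ => norm_seriesTerm_sub_le ..

theorem measurable_trunc (ω φ : ℝ) (s : Finset ℤ) : Measurable (trunc ω φ s) := by
  unfold trunc
  exact (Finset.measurable_sum _ fun n _ => measurable_seriesTerm ω φ n).div_const _

theorem trunc_add_one_left (ω φ : ℝ) (s : Finset ℤ) (t x y : ℝ) :
    trunc ω φ s (t + 1, x, y) = trunc ω φ s (t, x, y) := by
  have h := e_add_int t 1
  rw [Int.cast_one] at h
  simp only [trunc, seriesTerm_eq, h]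

theorem trunc_add_one_mid (ω φ : ℝ) (s : Finset ℤ) (t x y : ℝ) :
    trunc ω φ s (t, x + 1, y) = trunc ω φ s (t, x, y) := by
  have h : ∀ n : ℤ, e (n * (x + 1)) = e (n * x) := fun n =>
    e_eq_of_sub_eq_int n (by ring)
  simp only [trunc, seriesTerm_eq, h]

/-- The index `n` is an integer, so only the fractional part of `N/c`, which is what converges,
enters the series. -/
theorem trunc_fract (ω φ : ℝ) (s : Finset ℤ) : trunc ω (Int.fract φ) s = trunc ω φ s := by
  funext z
  have h : ∀ n : ℤ, e (-(n * Int.fract φ)) = e (-(n * φ)) := fun n =>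
    e_eq_of_sub_eq_int (n * ⌊φ⌋) (by
      rw [Int.fract]
      push_cast
      ring)
  obtain ⟨t, x, y⟩ := z
  simp only [trunc, seriesTerm_eq, h]

theorem tendsto_termAmp {ι : Type*} {F : Filter ι} {ω : ℝ} (n : ℤ) {y : ℝ}
    (hy : y ∈ Set.Ioo (0 : ℝ) 1) {ω' y' : ι → ℝ} (hω : Tendsto ω' F (𝓝 ω))
    (hy' : Tendsto y' F (𝓝 y)) :
    Tendsto (fun i => termAmp (ω' i) n (y' i)) F (𝓝 (termAmp ω n y)) := by
  unfold termAmp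
  have h1 : Tendsto (fun i => 1 / 2 * ((n : ℝ) - y' i) ^ 2 * ω' i) F
      (𝓝 (1 / 2 * ((n : ℝ) - y) ^ 2 * ω)) := (((hy'.const_sub _).pow 2).const_mul _).mul hω
  have h2 : Tendsto (fun i => (y' i : ℂ)) F (𝓝 (y : ℂ)) :=
    (Complex.continuous_ofReal.tendsto _).comp hy'
  refine ((continuous_e.tendsto _).comp h1).div (h2.const_sub _) ?_
  have h := intCast_sub_ne_zero hy n
  exact_mod_cast h

theorem tendsto_truncDist {ι : Type*} {F : Filter ι} {ω φ : ℝ} (s : Finset ℤ) {y : ℝ}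
    (hy : y ∈ Set.Ioo (0 : ℝ) 1) {ω' φ' y' : ι → ℝ} (hω : Tendsto ω' F (𝓝 ω))
    (hφ : Tendsto φ' F (𝓝 φ)) (hy' : Tendsto y' F (𝓝 y)) :
    Tendsto (fun i => truncDist (ω' i) (φ' i) ω φ s (y' i) y) F (𝓝 0) := by
  unfold truncDist
  rw [← Finset.sum_const_zero (s := s)]
  refine tendsto_finsetSum _ fun n _ => ?_
  have h1 : Tendsto (fun i => termAmp (ω' i) n (y' i)) F (𝓝 (termAmp ω n y)) :=
    tendsto_termAmp n hy hω hy'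
  have h2 : Tendsto (fun i => e (-(n * φ' i))) F (𝓝 (e (-(n * φ)))) :=
    (continuous_e.tendsto _).comp ((hφ.const_mul _).neg)
  have h3 := ((h2.sub_const (e (-(n * φ)))).norm.mul h1.norm).add
    ((h1.sub_const (termAmp ω n y)).norm.const_mul 2)
  simpa using h3

/-! ### Comparison of the Fourier sums with the truncated series -/

/-- Replacing each coefficient by its approximation costs the stated error. The approximate sum is
exactly a truncated series times one unimodular factor independent of `j` and `x`. -/
theorem exists_norm_coefSum_sub_trunc_le {N c : ℕ} [NeZero c] {d a g : ℤ} (h : d * a = 1 + c * g)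
    {δ C : ℝ} (hN : 0 < N) (hC : (N : ℝ) ^ 2 * |δ| ≤ C) (s : Finset ℤ) {y : ℝ}
    (hy : y ∈ Set.Ioo (0 : ℝ) 1) :
    ∃ r : ℝ, ∀ x, |‖coefSum N c d δ s y x‖ - ‖trunc ((a : ℝ) / c) ((N : ℝ) / c) s
      ((N : ℝ) / c * y + (1 / 2 - δ * (N * (N - 1) / 2)), x + r, y)‖| ≤
      (∑ j ∈ s, (6 * Real.pi * C + (2 * Real.pi * C) ^ 2) / (‖1 - e y‖ * |(j : ℝ) - y|)) *
        (c / N) := by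
  have hc : (c : ℝ) ≠ 0 := by exact_mod_cast NeZero.ne c
  set σ : ℝ := (a * g - d * a : ℤ) / 2 with hσ
  set θ : ℝ := δ * (N * (N - 1) / 2) - N * y / c with hθ
  set M : ℝ := (N : ℝ) / c with hM
  set ω : ℝ := (a : ℝ) / c with hω
  -- The translation collects every phase linear in `j`: `σ` from the Gauss sum, `M` from `e(jN/c)`,
  -- and `yω` to cancel the cross term of `(j-y)²ω/2`.
  refine ⟨σ + M + y * ω, fun x => ?_⟩
  set P : ℂ := ∑ j ∈ s, gauss c d j / (Real.sqrt c : ℂ) *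
      ((slow δ N * e (N * ((j - y) / c)) - 1) / (2 * Real.pi * Complex.I * ((j - y : ℝ) : ℂ))) *
        e (j * x) with hP
  set U : ℂ := gauss c d 0 / (Real.sqrt c : ℂ) * e θ * e (-(1 / 2 * y ^ 2 * ω)) / Complex.I with hU
  have hUn : ‖U‖ = 1 := by
    rw [hU, norm_div, norm_mul, norm_mul, norm_gauss_div h, norm_e, norm_e, Complex.norm_I]
    norm_num
  have hPeq : P = U * trunc ω M s (M * y + (1 / 2 - δ * (N * (N - 1) / 2)),
      x + (σ + M + y * ω), y) := by
    rw [hP, trunc, Finset.sum_div, Finset.mul_sum]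
    refine Finset.sum_congr rfl fun j _ => ?_
    -- The offset `1/2` in `t'` supplies the sign in `e(θ + jM) - 1 = e(θ + jM)(1 - e(-(θ + jM)))`.
    have hhalf : e (1 / 2) = -1 := by
      rw [e, ← Complex.exp_pi_mul_I]
      congr 1
      push_cast
      ring
    have e1 : slow δ N * e (N * ((j - y) / c)) = e θ * e (j * M) := by
      rw [slow, ← e_add, ← e_add]
      congr 1
      rw [hθ, hM]
      ring
    have e2 : e (M * y + (1 / 2 - δ * (N * (N - 1) / 2))) * e (-(j * M)) =
        -e (-(θ + j * M)) := by
      have : -e (-(θ + j * M)) = e (1 / 2) * e (-(θ + j * M)) := by rw [hhalf]; ring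
      rw [this, ← e_add, ← e_add]
      congr 1
      rw [hθ, hM]
      ring
    have e3 : e θ * e (j * M) * e (-(θ + j * M)) = 1 := by
      rw [← e_add, ← e_add, add_neg_cancel, e_zero]
    have e4 : e (j * (x + (σ + M + y * ω))) * e (1 / 2 * ((j : ℝ) - y) ^ 2 * ω) *
        e (-(1 / 2 * y ^ 2 * ω)) =
        e ((a : ℝ) * j ^ 2 / (2 * c) + j * σ) * e (j * M) * e (j * x) := by
      rw [← e_add, ← e_add, ← e_add, ← e_add]
      congr 1
      rw [hω]
      field_simp
      ring
    have e5 : e θ * e (j * M) - 1 = e θ * e (j * M) * (1 + -e (-(θ + j * M))) := by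
      linear_combination e3
    rw [gauss_eq h, ← hσ, seriesTerm_eq, termAmp, e1, e2, hU, e5, Complex.ofReal_sub,
      Complex.ofReal_intCast]
    generalize (j : ℂ) - (y : ℂ) = D
    linear_combination (-(gauss c d 0 / (Real.sqrt c : ℂ) * e θ * (1 + -e (-(θ + j * M))) /
      (2 * Real.pi * Complex.I * D))) * e4
  have hPn : ‖P‖ = ‖trunc ω M s (M * y + (1 / 2 - δ * (N * (N - 1) / 2)),
      x + (σ + M + y * ω), y)‖ := by rw [hPeq, norm_mul, hUn, one_mul]
  rw [← hPn]
  refine (abs_norm_sub_norm_le _ _).trans ?_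
  rw [coefSum, hP, ← Finset.sum_sub_distrib, Finset.sum_mul]
  refine norm_sum_le_of_le _ fun j _ => ?_
  rw [← sub_mul, norm_mul, norm_e, mul_one]
  exact norm_coef_sub_le h hN hC hy j

/-! ### Convergence of integrals of radial Lipschitz test functions. -/

section RadialTestFunction

variable {Ψ : ℂ → ℝ} {L K : ℝ}

theorem continuous_of_radial_lipschitz (hL0 : 0 ≤ L) (hL : ∀ ζ ξ, |Ψ ζ - Ψ ξ| ≤ L * |‖ζ‖ - ‖ξ‖|) :
    Continuous Ψ := by
  refine LipschitzWith.continuous (K := L.toNNReal) (LipschitzWith.of_dist_le_mul fun ζ ξ => ?_)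
  rw [Real.dist_eq, Real.coe_toNNReal _ hL0, dist_eq_norm]
  refine (hL ζ ξ).trans ?_
  gcongr
  exact abs_norm_sub_norm_le ζ ξ

theorem integrable_comp_of_bounded {X : Type*} [MeasurableSpace X] {μ : Measure X}
    [IsFiniteMeasure μ] (hΨ : Continuous Ψ) (hK : ∀ ζ, |Ψ ζ| ≤ K) {f : X → ℂ} (hf : Measurable f) :
    Integrable (fun x => Ψ (f x)) μ :=
  Integrable.of_bound (hΨ.measurable.comp hf).aestronglyMeasurable K (ae_of_all _ fun _ => hK _)

theorem abs_integral_le_of_abs_le {X : Type*} [MeasurableSpace X] {μ : Measure X}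
    [IsProbabilityMeasure μ] {f : X → ℝ} {B : ℝ} (hf : ∀ᵐ x ∂μ, |f x| ≤ B) : |∫ x, f x ∂μ| ≤ B := by
  have hf' : ∀ᵐ x ∂μ, ‖f x‖ ≤ B := hf
  simpa using norm_integral_le_of_norm_le_const hf'

/-- The mean over `x` of a function of the truncated series. -/
def truncMean (Ψ : ℂ → ℝ) (ω φ : ℝ) (s : Finset ℤ) (t y : ℝ) : ℝ :=
  ∫ x, Ψ (trunc ω φ s (t, x, y)) ∂unif

theorem measurable_truncMean (hΨ : Continuous Ψ) (ω φ : ℝ) (s : Finset ℤ) :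
    Measurable (Function.uncurry (truncMean Ψ ω φ s)) := by
  have hg : Measurable fun p : (ℝ × ℝ) × ℝ => (p.1.1, p.2, p.1.2) := by fun_prop
  have h : StronglyMeasurable fun p : (ℝ × ℝ) × ℝ => Ψ (trunc ω φ s (p.1.1, p.2, p.1.2)) :=
    (hΨ.measurable.comp ((measurable_trunc ω φ s).comp hg)).stronglyMeasurable
  exact h.integral_prod_right'.measurable

theorem measurable_trunc_mid (ω φ : ℝ) (s : Finset ℤ) (t y : ℝ) :
    Measurable fun x => trunc ω φ s (t, x, y) := by
  have hg : Measurable fun x : ℝ => (t, x, y) := by fun_prop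
  exact (measurable_trunc ω φ s).comp hg

theorem abs_truncMean_le (hK : ∀ ζ, |Ψ ζ| ≤ K) (ω φ : ℝ) (s : Finset ℤ) (t y : ℝ) :
    |truncMean Ψ ω φ s t y| ≤ K :=
  abs_integral_le_of_abs_le (ae_of_all _ fun _ => hK _)

theorem abs_truncMean_sub_le (hL0 : 0 ≤ L) (hL : ∀ ζ ξ, |Ψ ζ - Ψ ξ| ≤ L * |‖ζ‖ - ‖ξ‖|)
    (hK : ∀ ζ, |Ψ ζ| ≤ K) (ω φ ω' φ' : ℝ) (s : Finset ℤ) (t y y' : ℝ) :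
    |truncMean Ψ ω φ s t y - truncMean Ψ ω' φ' s t y'| ≤ L * truncDist ω φ ω' φ' s y y' := by
  have hΨ := continuous_of_radial_lipschitz hL0 hL
  rw [truncMean, truncMean, ← integral_sub
    (integrable_comp_of_bounded hΨ hK (measurable_trunc_mid ω φ s t y))
    (integrable_comp_of_bounded hΨ hK (measurable_trunc_mid ω' φ' s t y'))]
  refine abs_integral_le_of_abs_le (ae_of_all _ fun x => (hL _ _).trans ?_)
  gcongr
  exact (abs_norm_sub_norm_le _ _).trans (norm_trunc_sub_le ..)

theorem integral_truncMean (hΨ : Continuous Ψ) (hK : ∀ ζ, |Ψ ζ| ≤ K) (ω φ : ℝ) (s : Finset ℤ) :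
    ∫ t, ∫ y, truncMean Ψ ω φ s t y ∂unif ∂unif = ∫ z, Ψ (trunc ω φ s z) ∂unif3 := by
  rw [unif3, integral_prod _ (integrable_comp_of_bounded hΨ hK (measurable_trunc ω φ s))]
  congr 1
  funext t
  have hg : Measurable fun p : ℝ × ℝ => trunc ω φ s (t, p) :=
    (measurable_trunc ω φ s).comp measurable_prodMk_left
  rw [integral_prod_symm _ (integrable_comp_of_bounded hΨ hK hg)]
  rfl

theorem abs_integral_coefSum_sub_truncMean_le (hL0 : 0 ≤ L)
    (hL : ∀ ζ ξ, |Ψ ζ - Ψ ξ| ≤ L * |‖ζ‖ - ‖ξ‖|) (hK : ∀ ζ, |Ψ ζ| ≤ K)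
    {N c : ℕ} [NeZero c] {d a g : ℤ} (h : d * a = 1 + c * g)
    {δ C : ℝ} (hN : 0 < N) (hC : (N : ℝ) ^ 2 * |δ| ≤ C) (s : Finset ℤ) {y : ℝ}
    (hy : y ∈ Set.Ioo (0 : ℝ) 1) :
    |∫ x, Ψ (coefSum N c d δ s y x) ∂unif - truncMean Ψ ((a : ℝ) / c) (Int.fract ((N : ℝ) / c)) s
      ((N : ℝ) / c * y + (1 / 2 - δ * (N * (N - 1) / 2))) y| ≤
      L * ((∑ j ∈ s, (6 * Real.pi * C + (2 * Real.pi * C) ^ 2) / (‖1 - e y‖ * |(j : ℝ) - y|)) *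
        (c / N)) := by
  have hΨ := continuous_of_radial_lipschitz hL0 hL
  obtain ⟨r, hr⟩ := exists_norm_coefSum_sub_trunc_le h hN hC s hy
  set T := (N : ℝ) / c * y + (1 / 2 - δ * (N * (N - 1) / 2))
  have hp : Function.Periodic (fun x => Ψ (trunc ((a : ℝ) / c) ((N : ℝ) / c) s (T, x, y))) 1 :=
    fun x => by simp only [trunc_add_one_mid]
  have hg : Measurable fun x : ℝ => trunc ((a : ℝ) / c) ((N : ℝ) / c) s (T, x + r, y) :=
    (measurable_trunc_mid _ _ s T y).comp (measurable_add_const r)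
  rw [truncMean, trunc_fract, ← integral_unif_add_right hp r, ← integral_sub
    (integrable_comp_of_bounded hΨ hK (measurable_coefSum_right N c d δ s y))
    (integrable_comp_of_bounded hΨ hK hg)]
  refine abs_integral_le_of_abs_le (ae_of_all _ fun x => (hL _ _).trans ?_)
  gcongr
  exact hr x

theorem measurable_coefSum (N c : ℕ) (d : ℤ) (δ : ℝ) (s : Finset ℤ) :
    Measurable (Function.uncurry (coefSum N c d δ s)) := by
  unfold coefSum coef Function.uncurry
  refine Finset.measurable_sum _ fun j _ => Measurable.mul (Measurable.const_mul
    (Measurable.div (Measurable.mul ?_ ?_) ?_) _) (measurable_e.comp (by fun_prop))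
  · exact measurable_const.sub (measurable_e.comp (by fun_prop))
  · exact Finset.measurable_sum _ fun n _ => (measurable_e.comp (by fun_prop)).const_mul _
  · exact (Complex.measurable_ofReal.comp (by fun_prop)).const_mul _

theorem measurable_integral_coefSum (hΨ : Continuous Ψ) (N c : ℕ) (d : ℤ) (δ : ℝ)
    (s : Finset ℤ) : Measurable fun y => ∫ x, Ψ (coefSum N c d δ s y x) ∂unif := by
  have h : StronglyMeasurable fun p : ℝ × ℝ => Ψ (Function.uncurry (coefSum N c d δ s) p) :=
    (hΨ.measurable.comp (measurable_coefSum N c d δ s)).stronglyMeasurable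
  exact h.integral_prod_right'.measurable

theorem measurable_integral_profile (hΨ : Continuous Ψ) (N c : ℕ) (d : ℤ) (δ : ℝ) :
    Measurable fun y => ∫ x, Ψ (profile N c d δ y x) ∂unif := by
  have h : StronglyMeasurable fun p : ℝ × ℝ => Ψ (profile N c d δ p.1 p.2) :=
    (hΨ.measurable.comp (measurable_profile N c d δ)).stronglyMeasurable
  exact h.integral_prod_right'.measurable

theorem abs_integral_profile_sub_coefSum_le (hL0 : 0 ≤ L)
    (hL : ∀ ζ ξ, |Ψ ζ - Ψ ξ| ≤ L * |‖ζ‖ - ‖ξ‖|) (hK : ∀ ζ, |Ψ ζ| ≤ K)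
    {N c : ℕ} [NeZero c] {d a g : ℤ} (h : d * a = 1 + c * g)
    {δ C : ℝ} (hN : 0 < N) (hC : (N : ℝ) ^ 2 * |δ| ≤ C) {s : Finset ℤ} (h0 : 0 ∈ s) (h1 : 1 ∈ s)
    {η : ℝ} (hη : 0 < η) :
    |∫ y, ∫ x, Ψ (profile N c d δ y x) ∂unif ∂unif -
      ∫ y, ∫ x, Ψ (coefSum N c d δ s y x) ∂unif ∂unif| ≤
      L * (η + (2 * (2 + 2 * Real.pi * C)) ^ 2 * tailSq s / η) := by
  have hΨ := continuous_of_radial_lipschitz hL0 hL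
  rw [← integral_sub]
  · refine abs_integral_le_of_abs_le ?_
    filter_upwards [ae_unif_mem_Ioo] with y hy
    have hi1 := integrable_comp_of_bounded (μ := unif) hΨ hK (measurable_profile_right N c d δ y)
    have hi2 := integrable_comp_of_bounded (μ := unif) hΨ hK (measurable_coefSum_right N c d δ s y)
    have hi3 : Integrable (fun x => ‖profile N c d δ y x - coefSum N c d δ s y x‖) unif :=
      (integrable_unif_of_bound
        ((measurable_profile_right N c d δ y).sub (measurable_coefSum_right N c d δ s y))
        (B := N / Real.sqrt c + ∑ j ∈ s, ‖coef N c d δ y j‖) fun x => (norm_sub_le _ _).trans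
          (add_le_add (norm_profile_le ..) (norm_coefSum_le ..))).norm
    rw [← integral_sub hi1 hi2]
    calc |∫ x, (Ψ (profile N c d δ y x) - Ψ (coefSum N c d δ s y x)) ∂unif|
        ≤ ∫ x, |Ψ (profile N c d δ y x) - Ψ (coefSum N c d δ s y x)| ∂unif :=
          abs_integral_le_integral_abs
      _ ≤ ∫ x, L * ‖profile N c d δ y x - coefSum N c d δ s y x‖ ∂unif := by
          refine integral_mono (hi1.sub hi2).abs (hi3.const_mul L) fun x => (hL _ _).trans ?_
          gcongr
          exact abs_norm_sub_norm_le _ _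
      _ ≤ _ := by
          rw [integral_const_mul]
          gcongr
          exact integral_norm_profile_sub_le h hN hC hy h0 h1 hη
  · exact Integrable.of_bound (measurable_integral_profile hΨ N c d δ).aestronglyMeasurable K
      (ae_of_all _ fun y => abs_integral_le_of_abs_le (ae_of_all _ fun _ => hK _))
  · exact Integrable.of_bound (measurable_integral_coefSum hΨ N c d δ s).aestronglyMeasurable K
      (ae_of_all _ fun y => abs_integral_le_of_abs_le (ae_of_all _ fun _ => hK _))

theorem tendsto_integral_truncMean (hL0 : 0 ≤ L) (hL : ∀ ζ ξ, |Ψ ζ - Ψ ξ| ≤ L * |‖ζ‖ - ‖ξ‖|)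
    (hK : ∀ ζ, |Ψ ζ| ≤ K) (ω φ : ℝ) (s : Finset ℤ) {M κ : ℕ → ℝ} (hM : Tendsto M atTop atTop) :
    Tendsto (fun i => ∫ y, truncMean Ψ ω φ s (M i * y + κ i) y ∂unif) atTop
      (𝓝 (∫ z, Ψ (trunc ω φ s z) ∂unif3)) := by
  have hΨ := continuous_of_radial_lipschitz hL0 hL
  rw [← integral_truncMean hΨ hK]
  have hper : ∀ y, Function.Periodic (fun t => truncMean Ψ ω φ s t y) 1 := fun y t => by
    simp only [truncMean, trunc_add_one_left]
  refine tendsto_integral_phase (measurable_truncMean hΨ ω φ s) (abs_truncMean_le hK ω φ s)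
    hper ?_ hM
  intro y hy
  refine ⟨fun y' => L * truncDist ω φ ω φ s y' y, ?_, fun t y' => ?_⟩
  · have h := (tendsto_truncDist (F := 𝓝 y) s hy (tendsto_const_nhds (x := ω))
      (tendsto_const_nhds (x := φ)) tendsto_id).const_mul L
    rw [mul_zero] at h
    exact h
  · exact abs_truncMean_sub_le hL0 hL hK ω φ ω φ s t y' y

/-- For fixed `y` in `(0,1)` the error `c/N` and the parameter errors in `ω`, `φ` vanish. The
constants blow up at the endpoints, so dominated convergence in `y` replaces uniformity; the
equidistribution result handles what remains. -/
theorem tendsto_integral_coefSum (hL0 : 0 ≤ L) (hL : ∀ ζ ξ, |Ψ ζ - Ψ ξ| ≤ L * |‖ζ‖ - ‖ξ‖|)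
    (hK : ∀ ζ, |Ψ ζ| ≤ K) {N c : ℕ → ℕ} {d a g : ℕ → ℤ} {δ : ℕ → ℝ} {C ω φ : ℝ}
    (hev : ∀ᶠ i in atTop, 0 < N i ∧ 0 < c i ∧ d i * a i = 1 + c i * g i ∧
      (N i : ℝ) ^ 2 * |δ i| ≤ C)
    (hω : Tendsto (fun i => (a i : ℝ) / c i) atTop (𝓝 ω))
    (hφ : Tendsto (fun i => Int.fract ((N i : ℝ) / c i)) atTop (𝓝 φ))
    (hc : Tendsto (fun i => (c i : ℝ) / N i) atTop (𝓝 0)) (s : Finset ℤ) :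
    Tendsto (fun i => ∫ y, ∫ x, Ψ (coefSum (N i) (c i) (d i) (δ i) s y x) ∂unif ∂unif) atTop
      (𝓝 (∫ z, Ψ (trunc ω φ s z) ∂unif3)) := by
  have hΨ := continuous_of_radial_lipschitz hL0 hL
  have hM : Tendsto (fun i => (N i : ℝ) / c i) atTop atTop := by
    have h : Tendsto (fun i => (c i : ℝ) / N i) atTop (𝓝[>] 0) := by
      refine tendsto_nhdsWithin_iff.2 ⟨hc, ?_⟩
      filter_upwards [hev] with i hi
      have h1 : (0 : ℝ) < N i := by exact_mod_cast hi.1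
      have h2 : (0 : ℝ) < c i := by exact_mod_cast hi.2.1
      exact div_pos h2 h1
    refine h.inv_tendsto_nhdsGT_zero.congr fun i => ?_
    simp
  have hmain := tendsto_integral_truncMean hL0 hL hK ω φ s
    (κ := fun i => 1 / 2 - δ i * (N i * (N i - 1) / 2)) hM
  set t : ℕ → ℝ → ℝ := fun i y => (N i : ℝ) / c i * y + (1 / 2 - δ i * (N i * (N i - 1) / 2)) with ht
  have htm : ∀ i, Measurable fun y => truncMean Ψ ω φ s (t i y) y := fun i => by
    have hg : Measurable fun y : ℝ => (t i y, y) := by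
      simp only [ht]
      fun_prop
    have h := (measurable_truncMean hΨ ω φ s).comp hg
    simpa only [Function.comp_def, Function.uncurry_apply_pair] using h
  have hJm := fun i => measurable_integral_coefSum hΨ (N i) (c i) (d i) (δ i) s
  have hJb : ∀ i y, |∫ x, Ψ (coefSum (N i) (c i) (d i) (δ i) s y x) ∂unif| ≤ K := fun i y =>
    abs_integral_le_of_abs_le (ae_of_all _ fun _ => hK _)
  have hdiff : Tendsto (fun i => ∫ y, (∫ x, Ψ (coefSum (N i) (c i) (d i) (δ i) s y x) ∂unif -
      truncMean Ψ ω φ s (t i y) y) ∂unif) atTop (𝓝 (∫ _, (0 : ℝ) ∂unif)) := by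
    refine tendsto_integral_of_dominated_convergence (fun _ => K + K)
      (fun i => ((hJm i).sub (htm i)).aestronglyMeasurable) (integrable_const _)
      (fun i => ae_of_all _ fun y => (norm_sub_le _ _).trans
        (add_le_add (hJb i y) (abs_truncMean_le hK _ _ _ _ _))) ?_
    filter_upwards [ae_unif_mem_Ioo] with y hy
    set E := ∑ j ∈ s, (6 * Real.pi * C + (2 * Real.pi * C) ^ 2) / (‖1 - e y‖ * |(j : ℝ) - y|)
    have h1 : Tendsto (fun i => L * (E * ((c i : ℝ) / N i)) + L * truncDist ((a i : ℝ) / c i)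
        (Int.fract ((N i : ℝ) / c i)) ω φ s y y) atTop (𝓝 0) := by
      have h2 := ((hc.const_mul E).const_mul L).add
        ((tendsto_truncDist s hy hω hφ (tendsto_const_nhds (x := y))).const_mul L)
      simpa using h2
    refine squeeze_zero_norm' ?_ h1
    filter_upwards [hev] with i hi
    have : NeZero (c i) := ⟨hi.2.1.ne'⟩
    refine (norm_sub_le_norm_sub_add_norm_sub _ (truncMean Ψ ((a i : ℝ) / c i)
      (Int.fract ((N i : ℝ) / c i)) s (t i y) y) _).trans (add_le_add ?_ ?_)
    · exact abs_integral_coefSum_sub_truncMean_le hL0 hL hK hi.2.2.1 hi.1 hi.2.2.2 s hy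
    · exact abs_truncMean_sub_le hL0 hL hK ..
  rw [integral_zero] at hdiff
  have h3 := hdiff.add hmain
  rw [zero_add] at h3
  refine h3.congr fun i => ?_
  rw [integral_sub, sub_add_cancel]
  · exact Integrable.of_bound (hJm i).aestronglyMeasurable K (ae_of_all _ (hJb i))
  · exact Integrable.of_bound (htm i).aestronglyMeasurable K
      (ae_of_all _ fun y => abs_truncMean_le hK _ _ _ _ _)

/-- Convergence in probability implies convergence in distribution, also along the directed set of
finite index sets. -/
theorem tendsto_integral_trunc (hΨ : Continuous Ψ) (hK : ∀ ζ, |Ψ ζ| ≤ K) (ω φ : ℝ) :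
    Tendsto (fun s => ∫ z, Ψ (trunc ω φ s z) ∂unif3) atTop
      (𝓝 (∫ z, Ψ (seriesSum ω φ z / (2 * Real.pi)) ∂unif3)) := by
  have h := (seriesSum_spec ω φ).2.tendstoInDistribution fun s =>
    (Finset.measurable_sum s fun n _ => measurable_seriesTerm ω φ n).aemeasurable
  have hcont : Continuous fun ζ : ℂ => Ψ (ζ / (2 * Real.pi)) := hΨ.comp (continuous_id.div_const _)
  let f : BoundedContinuousFunction ℂ ℝ :=
    BoundedContinuousFunction.ofNormedAddCommGroup (fun ζ : ℂ => Ψ (ζ / (2 * Real.pi))) hcont K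
      fun ζ => hK _
  have h1 := (ProbabilityMeasure.tendsto_iff_forall_integral_tendsto.1 h.tendsto) f
  refine (h1.congr fun s => ?_).trans_eq ?_
  · exact integral_map (Finset.measurable_sum s fun n _ =>
      measurable_seriesTerm ω φ n).aemeasurable hcont.aestronglyMeasurable
  · congr 1
    exact integral_map (seriesSum_spec ω φ).1.aemeasurable hcont.aestronglyMeasurable

theorem tendsto_integral_profile (hL0 : 0 ≤ L) (hL : ∀ ζ ξ, |Ψ ζ - Ψ ξ| ≤ L * |‖ζ‖ - ‖ξ‖|)
    (hK : ∀ ζ, |Ψ ζ| ≤ K) {N c : ℕ → ℕ} {d a g : ℕ → ℤ} {δ : ℕ → ℝ} {C ω φ : ℝ}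
    (hev : ∀ᶠ i in atTop, 0 < N i ∧ 0 < c i ∧ d i * a i = 1 + c i * g i ∧
      (N i : ℝ) ^ 2 * |δ i| ≤ C)
    (hω : Tendsto (fun i => (a i : ℝ) / c i) atTop (𝓝 ω))
    (hφ : Tendsto (fun i => Int.fract ((N i : ℝ) / c i)) atTop (𝓝 φ))
    (hc : Tendsto (fun i => (c i : ℝ) / N i) atTop (𝓝 0)) :
    Tendsto (fun i => ∫ y, ∫ x, Ψ (profile (N i) (c i) (d i) (δ i) y x) ∂unif ∂unif) atTop
      (𝓝 (∫ z, Ψ (seriesSum ω φ z / (2 * Real.pi)) ∂unif3)) := by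
  have hΨ := continuous_of_radial_lipschitz hL0 hL
  rw [Metric.tendsto_atTop']
  intro ε hε
  -- The order of choices is `η`, then `s`, then `i`: the Parseval error must be uniform in `i`. The
  -- final budget is `ε/2 + ε/4 + ε/4`.
  set η : ℝ := ε / (4 * (L + 1)) with hη
  have hη0 : 0 < η := by positivity
  have hLη : L * η ≤ ε / 4 := by
    rw [hη, mul_div_assoc', div_le_div_iff₀ (by positivity) (by positivity)]
    nlinarith
  have htail : Tendsto (fun s => L * (η + (2 * (2 + 2 * Real.pi * C)) ^ 2 * tailSq s / η)) atTop
      (𝓝 (L * η)) := by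
    have h := (((tendsto_tailSq.const_mul ((2 * (2 + 2 * Real.pi * C)) ^ 2)).div_const η).const_add
      η).const_mul L
    simpa using h
  obtain ⟨s, hs1, hs2, hs3⟩ := ((htail.eventually_lt_const (u := ε / 2) (by linarith)).and
    ((Metric.tendsto_nhds.1 (tendsto_integral_trunc hΨ hK ω φ) (ε / 4) (by positivity)).and
      (eventually_ge_atTop ({0, 1} : Finset ℤ)))).exists
  have h4 := Metric.tendsto_nhds.1 (tendsto_integral_coefSum hL0 hL hK hev hω hφ hc s) (ε / 4)
    (by positivity)
  obtain ⟨n, hn⟩ := eventually_atTop.1 (hev.and h4)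
  refine ⟨n, fun i hi => ?_⟩
  obtain ⟨h5, h6⟩ := hn i hi.le
  have : NeZero (c i) := ⟨h5.2.1.ne'⟩
  have h7 := abs_integral_profile_sub_coefSum_le hL0 hL hK h5.2.2.1 h5.1 h5.2.2.2
    (hs3 (by simp)) (hs3 (by simp)) hη0
  rw [← Real.dist_eq] at h7
  have h8 := dist_triangle4
    (∫ y, ∫ x, Ψ (profile (N i) (c i) (d i) (δ i) y x) ∂unif ∂unif)
    (∫ y, ∫ x, Ψ (coefSum (N i) (c i) (d i) (δ i) s y x) ∂unif ∂unif)
    (∫ z, Ψ (trunc ω φ s z) ∂unif3) (∫ z, Ψ (seriesSum ω φ z / (2 * Real.pi)) ∂unif3)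
  linarith

end RadialTestFunction

/-! ### The arithmetic data -/

/-- Dirichlet's approximation theorem shows that the set defining `cN` is nonempty. -/
theorem cN_mem {N : ℕ} (hN : 0 < N) (u : ℝ) :
    0 < cN N u ∧ distInt (cN N u * u) ≤ (N : ℝ)⁻¹ := by
  have hne : {c : ℕ | 0 < c ∧ distInt (c * u) ≤ (N : ℝ)⁻¹}.Nonempty := by
    obtain ⟨k, hk0, -, hk⟩ := Real.exists_nat_abs_mul_sub_round_le u hN
    refine ⟨k, hk0, hk.trans ?_⟩
    have hN' : (0 : ℝ) < N := by exact_mod_cast hN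
    rw [one_div]
    gcongr
    linarith
  exact Nat.sInf_mem hne

theorem abs_add_dN (N : ℕ) (u : ℝ) : |(cN N u : ℝ) * u + dN N u| = distInt (cN N u * u) := by
  rw [distInt, dN, round_eq]
  push_cast
  rfl

/-- A common factor `r ≥ 2` could be divided out, giving a smaller denominator with an approximation
at least as good, against minimality. -/
theorem isCoprime_dN {N : ℕ} (hN : 0 < N) (u : ℝ) : IsCoprime (dN N u) (cN N u : ℤ) := by
  obtain ⟨hc0, hc⟩ := cN_mem hN u
  rw [Int.isCoprime_iff_gcd_eq_one]
  set r := Int.gcd (dN N u) (cN N u) with hr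
  have hr0 : 0 < r := Int.gcd_pos_of_ne_zero_right _ (by exact_mod_cast hc0.ne')
  by_contra hr1
  have hr2 : 2 ≤ r := by omega
  obtain ⟨d', hd'⟩ : (r : ℤ) ∣ dN N u := Int.gcd_dvd_left ..
  obtain ⟨c', hc'⟩ : r ∣ cN N u := by
    have h : (r : ℤ) ∣ (cN N u : ℤ) := Int.gcd_dvd_right ..
    exact_mod_cast h
  have hc'0 : 0 < c' := by
    rcases Nat.eq_zero_or_pos c' with h | h
    · rw [h, mul_zero] at hc'
      omega
    · exact h
  have hlt : c' < cN N u := by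
    rw [hc']
    nlinarith
  refine Nat.notMem_of_lt_sInf hlt ⟨hc'0, ?_⟩
  have h1 : (r : ℝ) * |(c' : ℝ) * u + d'| = distInt (cN N u * u) := by
    have h2 : (cN N u : ℝ) = r * c' := by exact_mod_cast hc'
    have h3 : (dN N u : ℝ) = r * d' := by exact_mod_cast hd'
    rw [← abs_add_dN, h3, h2, mul_assoc, ← mul_add, abs_mul, Nat.abs_cast]
  have h4 : distInt (c' * u) ≤ |(c' : ℝ) * u + d'| := by
    have h5 := round_le ((c' : ℝ) * u) (-d')
    rw [distInt]
    refine h5.trans (le_of_eq ?_)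
    push_cast
    rw [sub_neg_eq_add]
  have hr3 : (1 : ℝ) ≤ r := by exact_mod_cast hr0
  nlinarith [abs_nonneg ((c' : ℝ) * u + d')]

theorem exists_dN_mul_aN {N : ℕ} (hN : 0 < N) (u : ℝ) :
    ∃ g : ℤ, dN N u * (aN N u : ℤ) = 1 + cN N u * g := by
  have hne : NeZero (cN N u) := ⟨(cN_mem hN u).1.ne'⟩
  have hunit : IsUnit (dN N u : ZMod (cN N u)) := by
    obtain ⟨p, q, hpq⟩ := isCoprime_dN hN u
    refine isUnit_of_mul_eq (a := p) (g := -q) ?_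
    linear_combination hpq
  have h : ((dN N u * (aN N u : ℤ) - 1 : ℤ) : ZMod (cN N u)) = 0 := by
    push_cast
    rw [aN, ZMod.natCast_zmod_val, ZMod.mul_inv_of_unit _ hunit, sub_self]
  obtain ⟨g, hg⟩ := (ZMod.intCast_zmod_eq_zero_iff_dvd _ _).1 h
  exact ⟨g, by linear_combination hg⟩

theorem fract_aN_div {N : ℕ} (hN : 0 < N) (u : ℝ) :
    Int.fract ((aN N u : ℝ) / cN N u) = (aN N u : ℝ) / cN N u := by
  have hne : NeZero (cN N u) := ⟨(cN_mem hN u).1.ne'⟩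
  have hc : (0 : ℝ) < cN N u := by exact_mod_cast (cN_mem hN u).1
  refine Int.fract_eq_self.2 ⟨by positivity, ?_⟩
  rw [div_lt_one hc]
  exact_mod_cast ZMod.val_lt _

/-! ### The test functions -/

theorem abs_rotMean_le {F : ℂ → ℝ} {K : ℝ} (hK : ∀ ζ, |F ζ| ≤ K) (ζ : ℂ) : |rotMean F ζ| ≤ K :=
  abs_integral_le_of_abs_le (ae_of_all _ fun _ => hK _)

/-- Points at the same angle on two concentric circles are as far apart as the radii differ. Control
by the moduli alone is what lets unimodular factors be discarded throughout. -/
theorem abs_rotMean_sub_le {F : ℂ → ℝ} {K : ℝ} (hK : ∀ ζ, |F ζ| ≤ K) {L : NNReal}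
    (hF : LipschitzWith L F) (ζ ξ : ℂ) :
    |rotMean F ζ - rotMean F ξ| ≤ L * |‖ζ‖ - ‖ξ‖| := by
  have hm : ∀ r : ℝ, Measurable fun t : ℝ => e t * (r : ℂ) := fun r => measurable_e.mul_const _
  rw [rotMean, rotMean, ← integral_sub (integrable_comp_of_bounded hF.continuous hK (hm _))
    (integrable_comp_of_bounded hF.continuous hK (hm _))]
  refine abs_integral_le_of_abs_le (ae_of_all _ fun t => ?_)
  have h := hF.dist_le_mul (e t * (‖ζ‖ : ℂ)) (e t * (‖ξ‖ : ℂ))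
  rw [Real.dist_eq, dist_eq_norm, ← mul_sub, norm_mul, norm_e, one_mul, ← Complex.ofReal_sub,
    Complex.norm_real, Real.norm_eq_abs] at h
  exact h

theorem integral_nu {F : ℂ → ℝ} (hF : Continuous F) {K : ℝ} (hK : ∀ ζ, |F ζ| ≤ K) (ω φ : ℝ) :
    ∫ ζ, F ζ ∂(nu ω φ : Measure ℂ) =
      ∫ z, rotMean F (seriesSum ω φ z / (2 * Real.pi)) ∂unif3 := by
  have h1 : ∫ ζ, F ζ ∂(nu ω φ : Measure ℂ) = ∫ w, F (Y ω φ w) ∂(unif.prod unif3) := by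
    rw [nu, ProbabilityMeasure.toMeasure_map, integral_map (measurable_Y ω φ).aemeasurable
      hF.aestronglyMeasurable]
    rfl
  rw [h1, integral_prod_symm _ (integrable_comp_of_bounded hF hK (measurable_Y ω φ))]
  congr 1
  funext z
  rw [rotMean]
  congr 1
  funext t
  have h : ‖seriesSum ω φ z / (2 * Real.pi)‖ = ‖seriesSum ω φ z‖ / (2 * Real.pi) := by
    rw [norm_div]
    simp [abs_of_pos Real.pi_pos]
  rw [Y, h]
  push_cast
  congr 1
  ring

theorem exists_bound_of_dist_le {F : ℂ → ℝ} {C : ℝ} (hC : ∀ x y, dist (F x) (F y) ≤ C) :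
    ∃ K, ∀ ζ, |F ζ| ≤ K := by
  refine ⟨|F 0| + C, fun ζ => ?_⟩
  have h := hC ζ 0
  rw [Real.dist_eq] at h
  have h2 := abs_add_le (F 0) (F ζ - F 0)
  rw [add_sub_cancel] at h2
  linarith

end SkewSums

end

/-! ### The limit theorem. -/

theorem mainTheorem5 (α : ℝ) (k l : ℤ) (hl : l ≠ 0) (u : ℝ) (hu : u = (l : ℝ) * α)
    (N : ℕ → ℕ) (hN : Tendsto N atTop atTop) (ω φ : ℝ)
    (hφ : Tendsto (fun i => Int.fract ((N i : ℝ) / (SkewSums.cN (N i) u : ℝ))) atTop (𝓝 φ))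
    (hω : Tendsto (fun i => Int.fract ((SkewSums.aN (N i) u : ℝ) / (SkewSums.cN (N i) u : ℝ)))
      atTop (𝓝 ω))
    (hc : Tendsto (fun i => (SkewSums.cN (N i) u : ℝ) / (N i : ℝ)) atTop (𝓝 0))
    (hb : IsBoundedUnder (· ≤ ·) atTop fun i =>
      (N i : ℝ) ^ 2 * SkewSums.distInt ((SkewSums.cN (N i) u : ℝ) * u) /
        (SkewSums.cN (N i) u : ℝ)) :
    Tendsto (fun i => SkewSums.rhoTilde (N i) α k l) atTop (𝓝 (SkewSums.nu ω φ)) := by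
  open SkewSums in
  rw [tendsto_iff_forall_lipschitz_integral_tendsto]
  rintro F ⟨B, hB⟩ ⟨L, hF⟩
  obtain ⟨K, hK⟩ := exists_bound_of_dist_le hB
  obtain ⟨C, hC⟩ := hb
  rw [eventually_map] at hC
  have hpos : ∀ᶠ i in atTop, 0 < N i := hN.eventually_gt_atTop 0
  -- The value `0` for `N i = 0` only makes `g` total; it concerns finitely many `i`.
  have hinv : ∀ i, ∃ g : ℤ, 0 < N i → dN (N i) u * (aN (N i) u : ℤ) = 1 + cN (N i) u * g := by
    intro i
    by_cases h : 0 < N i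
    · obtain ⟨g, hg⟩ := exists_dN_mul_aN h u
      exact ⟨g, fun _ => hg⟩
    · exact ⟨0, fun h' => absurd h' h⟩
  choose g hg using hinv
  -- This `δ` satisfies `u = -d/c + δ` and `|δ| = ‖cu‖/c`, so the limsup hypothesis is precisely the
  -- bound on `N²|δ|`.
  set δ : ℕ → ℝ := fun i => ((cN (N i) u : ℝ) * u + dN (N i) u) / cN (N i) u with hδ
  have hev : ∀ᶠ i in atTop, 0 < N i ∧ 0 < cN (N i) u ∧
      dN (N i) u * (aN (N i) u : ℤ) = 1 + cN (N i) u * g i ∧ (N i : ℝ) ^ 2 * |δ i| ≤ C := by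
    filter_upwards [hpos, hC] with i hi hCi
    refine ⟨hi, (cN_mem hi u).1, hg i hi, ?_⟩
    rw [hδ, abs_div, abs_add_dN, Nat.abs_cast, ← mul_div_assoc]
    exact hCi
  have hω' : Tendsto (fun i => (((aN (N i) u : ℕ) : ℤ) : ℝ) / cN (N i) u) atTop (𝓝 ω) := by
    refine hω.congr' ?_
    filter_upwards [hpos] with i hi
    rw [fract_aN_div hi, Int.cast_natCast]
  have hL := abs_rotMean_sub_le hK hF
  have hΨ := continuous_of_radial_lipschitz L.coe_nonneg hL
  rw [integral_nu hF.continuous hK]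
  refine (tendsto_integral_profile L.coe_nonneg hL (abs_rotMean_le hK) hev hω' hφ hc).congr' ?_
  filter_upwards [hev] with i hi
  have hne : NeZero (cN (N i) u) := ⟨hi.2.1.ne'⟩
  have hci : (cN (N i) u : ℝ) ≠ 0 := by exact_mod_cast hne.ne
  rw [integral_rhoTilde hF.continuous hK _ _ _ hl, ← hu,
    ← integral_circleSum_eq hΨ (abs_rotMean_le hK) (fun ζ ξ h => by rw [rotMean, rotMean, h]) (N i)
      (isUnit_of_mul_eq hi.2.2.1) (δ i)]
  have hud : -(dN (N i) u : ℝ) / cN (N i) u + δ i = u := by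
    rw [hδ]
    field_simp
    ring
  rw [hud]
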